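/- Let $n\ge 0$ be an integer, $\hbar>0$, $\beta>0$, and let $\hat{\mathbf x}=(\hat q_1,\dots,\hat q_n,\hat p_1,\dots,\hat p_n)^{\mathsf T}$ be the position operators (multiplication by $x_j$) and momentum operators ($-i\hbar\,\partial_j$) on $\mathcal H=L^2(\mathbb R^n)$, acting on the Schwartz space $\mathcal S=\mathcal S(\mathbb R^n)$. Let $\mathsf J=\begin{pmatrix}0&1\\-1&0\end{pmatrix}$ in $n\times n$ blocks. Let $\hat H_{\rm eff}=\tfrac12\hat{\mathbf x}^{\mathsf T}B'\hat{\mathbf x}+\hat{\mathbf x}^{\mathsf T}\mathsf J\xi'$ with $B'$ a real symmetric $2n\times 2n$ matrix and $\xi'\in\mathbb R^{2n}$, and let $\hat L_k=\mathbf l_k^{\mathsf T}\mathsf J\hat{\mathbf x}$ with $\mathbf l_k\in\mathbb C^{2n}$, $k=1,\dots,K$. Put $$\bar{\mathcal L}[A]=\tfrac{i}{\hbar}[\hat H_{\rm eff},A]+\tfrac1{2\hbar}\sum_{k=1}^K\big(2\hat L_k^\dagger A\hat L_k-A\hat L_k^\dagger\hat L_k-\hat L_k^\dagger\hat L_kA\big).$$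 This expression is defined, through matrix elements $\langle\varphi,A\psi\rangle$ with $\varphi,\psi\in\mathcal S$, for every bounded operator $A$ on $\mathcal H$ and, more generally, for every tempered operator, i.e. every separately continuous sesquilinear form $A(\varphi,\psi)=\langle\varphi,A\psi\rangle$ on $\mathcal S$. A Gaussian dynamical semigroup (GDS) with these data is a weakly continuous semigroup $(\bar\Lambda_t)_{t\ge0}$ of normal, unital, completely positive linear maps on the bounded operators on $\mathcal H$ such that $$\tfrac{d}{dt}\langle\varphi,\bar\Lambda_t[X]\psi\rangle=\langle\varphi,\bar{\mathcal L}[\bar\Lambda_t[X]]\psi\rangle$$ for all bounded $X$, all $\varphi,\psi\in\mathcal S$ and all $t\ge0$. Let $\hat H=\tfrac12\hat{\mathbf x}^{\mathsf T}B\hat{\mathbf x}$ with $B$ real symmetric positive definite, and let $\hat{\bar\sigma}^{\rm th}=e^{-\beta\hat H}$. The GDS satisfies the $\hat{\bar\sigma}^{\rm th}$-detailed-balance condition if, for all $t\ge0$ and all bounded $A,C$, $$\mathrm{Tr}\big(e^{-\beta\hat H}\,\bar\Lambda_t[A]^\dagger\,C\big)=\mathrm{Tr}\big(e^{-\beta\hat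 H}\,A^\dagger\,\bar\Lambda_t[C]\big).$$ For $z\in\mathbb C$ let $\Xi_z[A]=e^{i\hat Hz/\hbar}\,A\,e^{-i\hat Hz/\hbar}$. A bounded operator $A$ is in the domain of $\Xi_z$, with $\Xi_z[A]=A'$ bounded, if for each $u$ in the domain of $e^{-i\hat Hz/\hbar}$ the vector $Ae^{-i\hat Hz/\hbar}u$ is in the domain of $e^{i\hat Hz/\hbar}$ and is mapped by it to $A'u$. For tempered operators, $\Xi_z[F]=F'$ means $F'(\varphi,\psi)=e^{i(E-E')z/\hbar}F(\varphi,\psi)$ for all eigenfunctions $\varphi,\psi\in\mathcal S$ of $\hat H$, with eigenvalues $E,E'$. For tempered operators, $\bar\Lambda_t[F]=G$ means that for every orthonormal basis $(e_i)$ of $\mathcal H$ consisting of eigenfunctions of $\hat H$ in $\mathcal S$, $\sum_{i,j}F(e_i,e_j)\,\langle\varphi,\bar\Lambda_t[\,|e_i\rangle\langle e_j|\,]\psi\rangle$ converges unconditionally to $G(\varphi,\psi)$ for all $\varphi,\psi\in\mathcal S$. **Theorem.** If the GDS $(\bar\Lambda_t)$ satisfies the $\hat{\bar\sigma}^{\rm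 th}$-detailed-balance condition, then $\bar\Lambda_t$ (for every $t\ge0$) and $\bar{\mathcal L}$ commute with $\Xi_z$ for every $z\in\mathbb C$. Precisely: 1. If $A$ is bounded and in the domain of $\Xi_z$, then so is $\bar\Lambda_t[A]$, and $\Xi_z[\bar\Lambda_t[A]]=\bar\Lambda_t[\Xi_z[A]]$. 2. If $F,F',G,G'$ are tempered operators with $\Xi_z[F]=F'$, $\bar\Lambda_t[F]=G$ and $\bar\Lambda_t[F']=G'$, then $\Xi_z[G]=G'$. 3. Regard $\bar{\mathcal L}$ as the infinitesimal generator of the semigroup on the bounded operators, i.e. the weak limit of $(\bar\Lambda_t[A]-A)/t$ as $t\to0^+$ where this exists. If $A$ is in the domains of $\bar{\mathcal L}$ and of $\Xi_z$, then $\Xi_z[A]$ is in the domain of $\bar{\mathcal L}$ if and only if $\bar{\mathcal L}[A]$ is in the domain of $\Xi_z$, and in that case $\bar{\mathcal L}[\Xi_z[A]]=\Xi_z[\bar{\mathcal L}[A]]$. 4. If $F,F'$ are tempered operators with $\Xi_z[F]=F'$, then $\Xi_z[\bar{\mathcal L}[F]]=\bar{\mathcal L}[F']$, with $\bar{\mathcal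 L}$ the Lindblad expression above. -/

import Mathlib

open scoped SchwartzMap InnerProductSpace

noncomputable section

namespace GDS

/-! ### The Hilbert space of `n` bosonic modes and the canonical operators -/

/-- Configuration space `ℝⁿ`. -/
abbrev Conf (n : ℕ) : Type := EuclideanSpace ℝ (Fin n)

/-- The Hilbert space `L²(ℝⁿ; ℂ)` of `n` bosonic modes. -/
abbrev Hilb (n : ℕ) : Type :=
  MeasureTheory.Lp ℂ 2 (MeasureTheory.volume : MeasureTheory.Measure (Conf n))

/-- The bounded operators on the Hilbert space (the observables). -/
abbrev Obs (n : ℕ) : Type := Hilb n →L[ℂ] Hilb n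

/-- The Schwartz space, the common invariant domain of the canonical operators. -/
abbrev Schw (n : ℕ) : Type := 𝓢(Conf n, ℂ)

/-- Index set of phase-space coordinates `(q₁, …, qₙ, p₁, …, pₙ)`. -/
abbrev Idx (n : ℕ) : Type := Fin n ⊕ Fin n

variable {n : ℕ}

/-- A Schwartz function as a vector of the Hilbert space. -/
def toH : Schw n →L[ℂ] Hilb n := SchwartzMap.toLpCLM ℂ ℂ 2 MeasureTheory.volume

/-- The position operator: `(q̂_j φ)(x) = x_j φ(x)`. -/
def qOp (j : Fin n) : Schw n →L[ℂ] Schw n :=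
  SchwartzMap.smulLeftCLM ℂ (fun x : Conf n => ((x j : ℝ) : ℂ))

/-- The momentum operator: `p̂_j = -iħ ∂_j`. -/
def pOp (ħ : ℝ) (j : Fin n) : Schw n →L[ℂ] Schw n :=
  (-(Complex.I * (ħ : ℂ))) •
    LineDeriv.lineDerivOpCLM ℂ (Schw n) (EuclideanSpace.single j (1 : ℝ) : Conf n)

/-- The vector of canonical operators `x̂ = (q̂₁, …, q̂ₙ, p̂₁, …, p̂ₙ)`. -/
def xOp (ħ : ℝ) : Idx n → (Schw n →L[ℂ] Schw n) :=
  Sum.elim qOp (pOp ħ)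

/-- The symplectic matrix `J = [[0, 1], [-1, 0]]`. -/
def symJ (n : ℕ) (R : Type) [Ring R] : Matrix (Idx n) (Idx n) R :=
  Matrix.fromBlocks 0 1 (-1) 0

/-- `cᵀ x̂ = ∑ j, c_j x̂_j`, for a complex coefficient vector. -/
def linOp (ħ : ℝ) (c : Idx n → ℂ) : Schw n →L[ℂ] Schw n :=
  ∑ j, c j • xOp ħ j

/-- `½ x̂ᵀ M x̂`, for a real matrix. -/
def quadOp (ħ : ℝ) (M : Matrix (Idx n) (Idx n) ℝ) : Schw n →L[ℂ] Schw n :=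
  (1 / 2 : ℂ) • ∑ j, ∑ k, ((M j k : ℝ) : ℂ) • (xOp ħ j).comp (xOp ħ k)

/-! ### The Lindblad generator in the Heisenberg picture -/

/-- The effective Hamiltonian `½ x̂ᵀ B' x̂ + x̂ᵀ J ξ'`. -/
def effHam (ħ : ℝ) (B' : Matrix (Idx n) (Idx n) ℝ) (ξ' : Idx n → ℝ) : Schw n →L[ℂ] Schw n :=
  quadOp ħ B' + linOp ħ (fun j => (((symJ n ℝ).mulVec ξ' j : ℝ) : ℂ))

/-- The Lindblad operator `L = lᵀ J x̂`. -/
def lindOp (ħ : ℝ) (l : Idx n → ℂ) : Schw n →L[ℂ] Schw n :=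
  linOp ħ (Matrix.vecMul l (symJ n ℂ))

/-- Its formal adjoint `L† = l†J x̂` (complex conjugate coefficients). -/
def lindOpAdj (ħ : ℝ) (l : Idx n → ℂ) : Schw n →L[ℂ] Schw n :=
  linOp ħ (Matrix.vecMul (star l) (symJ n ℂ))

/-- Observables, bounded or not, as matrix-element functions `(φ, ψ) ↦ ⟨φ, A ψ⟩` on the Schwartz
space: sesquilinear and separately continuous. By the kernel theorem these are exactly the operators
with a (distributional) Weyl or Wigner symbol. -/
structure IsTempered (F : Schw n → Schw n → ℂ) : Prop where
  add_right : ∀ φ ψ₁ ψ₂, F φ (ψ₁ + ψ₂) = F φ ψ₁ + F φ ψ₂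
  smul_right : ∀ (c : ℂ) φ ψ, F φ (c • ψ) = c * F φ ψ
  add_left : ∀ φ₁ φ₂ ψ, F (φ₁ + φ₂) ψ = F φ₁ ψ + F φ₂ ψ
  smul_left : ∀ (c : ℂ) φ ψ, F (c • φ) ψ = star c * F φ ψ
  cont_right : ∀ φ, Continuous (fun ψ => F φ ψ)
  cont_left : ∀ ψ, Continuous (fun φ => F φ ψ)

/-- The matrix elements of a bounded operator. -/
def matEl (A : Obs n) (φ ψ : Schw n) : ℂ := ⟪toH φ, A (toH ψ)⟫_ℂ

/-- The Heisenberg-picture Lindblad generator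
`L̄[A] = (i/ħ)[H_eff, A] + (1/2ħ) ∑ₖ (2 Lₖ† A Lₖ - A Lₖ† Lₖ - Lₖ† Lₖ A)`,
written on matrix elements: operators on the left of `A` are moved onto `φ`. -/
def lindblad {K : ℕ} (ħ : ℝ) (B' : Matrix (Idx n) (Idx n) ℝ) (ξ' : Idx n → ℝ)
    (l : Fin K → Idx n → ℂ) (F : Schw n → Schw n → ℂ) (φ ψ : Schw n) : ℂ :=
  (Complex.I / (ħ : ℂ)) * (F (effHam ħ B' ξ' φ) ψ - F φ (effHam ħ B' ξ' ψ)) +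
    (1 / (2 * (ħ : ℂ))) * ∑ k,
      (2 * F (lindOp ħ (l k) φ) (lindOp ħ (l k) ψ)
        - F φ (lindOpAdj ħ (l k) (lindOp ħ (l k) ψ))
        - F (lindOpAdj ħ (l k) (lindOp ħ (l k) φ)) ψ)

/-! ### Quantum dynamical semigroups and Gaussian dynamical semigroups -/

open scoped ComplexOrder in
/-- A quantum dynamical semigroup in the Heisenberg picture: a weakly continuous one-parameter
semigroup of unital, completely positive, normal maps on the bounded operators. Normality is stated
as continuity, on bounded sets, in the weak operator topology (equivalently the ultraweak one). -/
structure IsQDS (Λ : ℝ → (Obs n →ₗ[ℂ] Obs n)) : Prop where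
  zero : Λ 0 = LinearMap.id
  add : ∀ s t : ℝ, 0 ≤ s → 0 ≤ t → Λ (s + t) = (Λ s).comp (Λ t)
  unital : ∀ t : ℝ, 0 ≤ t → Λ t 1 = 1
  completelyPositive : ∀ t : ℝ, 0 ≤ t → ∀ (m : ℕ) (X : Fin m → Obs n) (v : Fin m → Hilb n),
    0 ≤ ∑ i, ∑ j, ⟪v i, Λ t ((ContinuousLinearMap.adjoint (X i)).comp (X j)) (v j)⟫_ℂ
  normal : ∀ t : ℝ, 0 ≤ t → ∀ (ι : Type) (f : Filter ι) (X : ι → Obs n) (X₀ : Obs n) (M : ℝ),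
    (∀ i, ‖X i‖ ≤ M) →
    (∀ u v, Filter.Tendsto (fun i => ⟪u, X i v⟫_ℂ) f (nhds ⟪u, X₀ v⟫_ℂ)) →
    ∀ u v, Filter.Tendsto (fun i => ⟪u, Λ t (X i) v⟫_ℂ) f (nhds ⟪u, Λ t X₀ v⟫_ℂ)
  continuous : ∀ (X : Obs n) (u v : Hilb n),
    ContinuousOn (fun t : ℝ => ⟪u, Λ t X v⟫_ℂ) (Set.Ici 0)

/-- A Gaussian dynamical semigroup: a quantum dynamical semigroup solving the Heisenberg-picture
master equation `d/dt Λ̄_t[X] = L̄[Λ̄_t[X]]`, in the sense of matrix elements between Schwartz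
vectors, for a quadratic effective Hamiltonian and Lindblad operators linear in `x̂`. -/
structure IsGDS {K : ℕ} (ħ : ℝ) (B' : Matrix (Idx n) (Idx n) ℝ) (ξ' : Idx n → ℝ)
    (l : Fin K → Idx n → ℂ) (Λ : ℝ → (Obs n →ₗ[ℂ] Obs n)) : Prop where
  isQDS : IsQDS Λ
  master : ∀ (X : Obs n) (φ ψ : Schw n) (t : ℝ), 0 ≤ t →
    HasDerivWithinAt (fun s : ℝ => matEl (Λ s X) φ ψ)
      (lindblad ħ B' ξ' l (matEl (Λ t X)) φ ψ) (Set.Ici 0) t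

/-- `C = L̄[A]` for the infinitesimal generator of the semigroup on the bounded operators:
`A` is in its domain and `C` is the weak limit of `(Λ̄_t[A] - A) / t` as `t → 0⁺`. -/
def IsGen (Λ : ℝ → (Obs n →ₗ[ℂ] Obs n)) (A C : Obs n) : Prop :=
  ∀ u v : Hilb n, Filter.Tendsto (fun t : ℝ => ((t : ℂ))⁻¹ * ⟪u, (Λ t A - A) v⟫_ℂ)
    (nhdsWithin 0 (Set.Ioi 0)) (nhds ⟪u, C v⟫_ℂ)

/-! ### Exponentials of the Hamiltonian `Ĥ = ½ x̂ᵀ B x̂` and the modular group -/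

/-- `φ` is a Schwartz function with `Ĥ φ = E φ`. For `B > 0` these functions span a dense
subspace (Hermite functions in suitable coordinates). -/
def IsEigen (ħ : ℝ) (B : Matrix (Idx n) (Idx n) ℝ) (E : ℝ) (φ : Schw n) : Prop :=
  quadOp ħ B φ = (E : ℂ) • φ

/-- The graph of the (in general unbounded) closed operator `e^{zĤ}`: the closure of the operator
acting on eigenfunctions by `φ ↦ e^{zE} φ`. So `(u, v) ∈ expGraph ħ B z` means that `u` is in the
domain of `e^{zĤ}` and `e^{zĤ} u = v`. -/
def expGraph (ħ : ℝ) (B : Matrix (Idx n) (Idx n) ℝ) (z : ℂ) : Submodule ℂ (Hilb n × Hilb n) :=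
  (Submodule.span ℂ {p : Hilb n × Hilb n | ∃ (φ : Schw n) (E : ℝ), IsEigen ħ B E φ ∧
    p = (toH φ, Complex.exp (z * (E : ℂ)) • toH φ)}).topologicalClosure

/-- `A' = Ξ_z[A] = e^{iĤz/ħ} A e^{-iĤz/ħ}` for bounded `A`, `A'` and complex `z`: for every `u` in the
domain of `e^{-iĤz/ħ}`, the vector `A e^{-iĤz/ħ} u` is in the domain of `e^{iĤz/ħ}`, which maps it to
`A' u`. -/
def IsModular (ħ : ℝ) (B : Matrix (Idx n) (Idx n) ℝ) (z : ℂ) (A A' : Obs n) : Prop :=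
  ∀ u v : Hilb n, (u, v) ∈ expGraph ħ B (-(Complex.I * z / (ħ : ℂ))) →
    (A v, A' u) ∈ expGraph ħ B (Complex.I * z / (ħ : ℂ))

/-- `F' = Ξ_z[F]` for possibly unbounded observables given by their matrix elements:
`⟨φ, e^{iĤz/ħ} F e^{-iĤz/ħ} ψ⟩ = e^{i(E - E')z/ħ} ⟨φ, F ψ⟩` for eigenfunctions `φ`, `ψ` with
eigenvalues `E`, `E'`. -/
def IsModularForm (ħ : ℝ) (B : Matrix (Idx n) (Idx n) ℝ) (z : ℂ)
    (F F' : Schw n → Schw n → ℂ) : Prop :=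
  ∀ (E E' : ℝ) (φ ψ : Schw n), IsEigen ħ B E φ → IsEigen ħ B E' ψ →
    F' φ ψ = Complex.exp (Complex.I * z / (ħ : ℂ) * ((E : ℂ) - (E' : ℂ))) * F φ ψ

/-- `G = Λ̄_t[F]` for possibly unbounded observables: expanding `F = ∑ F(e_i, e_j) |e_i⟩⟨e_j|` in an
orthonormal basis of Schwartz eigenfunctions of `Ĥ` and applying `T = Λ̄_t` term by term, all matrix
elements between Schwartz vectors converge (unconditionally) to those of `G`. -/
def IsEvolved (ħ : ℝ) (B : Matrix (Idx n) (Idx n) ℝ) (T : Obs n →ₗ[ℂ] Obs n)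
    (F G : Schw n → Schw n → ℂ) : Prop :=
  ∀ (ι : Type) (b : HilbertBasis ι ℂ (Hilb n)) (e : ι → Schw n) (E : ι → ℝ),
    (∀ i, toH (e i) = b i) → (∀ i, IsEigen ħ B (E i) (e i)) → ∀ φ ψ : Schw n,
      HasSum (fun p : ι × ι => F (e p.1) (e p.2) *
        matEl (T (InnerProductSpace.rankOne ℂ (b p.1) (b p.2))) φ ψ) (G φ ψ)

/-! ### Detailed balance -/

/-- The GNS inner product of `A` and `C` with respect to `e^{-βĤ}` is defined and equal to `c`:
`Tr(e^{-βĤ} A† C) = c`, i.e. `e^{-βĤ} A† C` is a trace-class operator and its trace, computed in any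
orthonormal basis, is `c`. -/
def HasGNS (ħ β : ℝ) (B : Matrix (Idx n) (Idx n) ℝ) (A C : Obs n) (c : ℂ) : Prop :=
  ∀ (ι : Type) (b : HilbertBasis ι ℂ (Hilb n)), ∃ f : ι → Hilb n,
    (∀ i, (ContinuousLinearMap.adjoint A (C (b i)), f i) ∈ expGraph ħ B (-(β : ℂ))) ∧
      HasSum (fun i => ⟪b i, f i⟫_ℂ) c

/-- Detailed balance with respect to `e^{-βĤ}`: each `Λ̄_t` is self-adjoint for the GNS inner
product, `Tr(e^{-βĤ} Λ̄_t[A]† C) = Tr(e^{-βĤ} A† Λ̄_t[C])`. -/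
def DetailedBalance (ħ β : ℝ) (B : Matrix (Idx n) (Idx n) ℝ)
    (Λ : ℝ → (Obs n →ₗ[ℂ] Obs n)) : Prop :=
  ∀ t : ℝ, 0 ≤ t → ∀ A C : Obs n, ∃ c : ℂ,
    HasGNS ħ β B (Λ t A) C c ∧ HasGNS ħ β B A (Λ t C) c

end GDS

end

noncomputable section

namespace GDS

variable {n : ℕ}

/-! ### Algebra of the canonical operators -/

/-! In an eigenbasis of `Ĥ`, with energies `E_i` and matrix units `|k⟩⟨l|`, `Ξ_z` is diagonal: it
multiplies the `(i, j)` matrix element by `exp(iz(E_i - E_j)/ħ)`. Hence a map commutes with every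
`Ξ_z` once it does not mix matrix units of different Bohr frequencies `E_i - E_j`. This is what
detailed balance forces (`inner_map_unit_eq_zero`). Testing it on matrix units relates `x = ⟨i,
Λ_t(|k⟩⟨l|) j⟩` to `y = ⟨Λ_t(|i⟩⟨j|) l, k⟩` by `w_j x = w_l y`, where `w_i = exp(-βE_i)`. Since
`Λ_t` preserves adjoints, the same identity for the adjoint units reads `w_i x = w_k y`. Eliminating
`y` gives `(w_j w_k - w_i w_l) x = 0`, so `x = 0` unless `E_i - E_j = E_k - E_l`.

The eigenbasis needs no diagonalisation of `B`. Detailed balance at `t = 0` for the identity says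
that `e^{-βĤ}` has a trace, and this already makes the eigenfunctions total and the eigenspaces
finite-dimensional (`HasTrace.exists_eigenBasis`).

For bounded operators, normality carries the selection rule from matrix units to all `A`
(`tendsto_sum_map_unit`, `isModular_map`); for evolved forms it applies termwise in the defining
series. For the bounded generator, `isGen_of_dense` recovers weak convergence on all vectors from
derivatives on the span of the basis.

For the Lindblad expression on unbounded forms, the point is finiteness. Commutators of `Ĥ` with
canonical operators are again linear in them, so applying at most two canonical operators to an
eigenfunction stays in the span of finitely many basis vectors. There a form is a finite combination
of matrix units, and the master equation at time zero transfers the selection rule to `lindblad`. -/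

theorem hasTemperateGrowth_coord (j : Fin n) :
    (fun x : Conf n => ((x j : ℝ) : ℂ)).HasTemperateGrowth :=
  (Complex.ofRealCLM.comp (EuclideanSpace.proj (𝕜 := ℝ) j : Conf n →L[ℝ] ℝ)).hasTemperateGrowth

theorem qOp_apply (j : Fin n) (φ : Schw n) (x : Conf n) : qOp j φ x = (x j : ℂ) * φ x := by
  simp [qOp, SchwartzMap.smulLeftCLM_apply_apply (hasTemperateGrowth_coord j)]

theorem pOp_apply (ħ : ℝ) (j : Fin n) (φ : Schw n) :
    pOp ħ j φ = (-(Complex.I * (ħ : ℂ))) •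
      LineDeriv.lineDerivOp (EuclideanSpace.single j (1 : ℝ) : Conf n) φ := rfl

theorem lineDerivOp_qOp (j : Fin n) (v : Conf n) (φ : Schw n) :
    LineDeriv.lineDerivOp v (qOp j φ) = (v j : ℂ) • φ + qOp j (LineDeriv.lineDerivOp v φ) := by
  ext x
  have h1 : (qOp j φ : Conf n → ℂ) = fun x => (Complex.ofRealCLM.comp
      (EuclideanSpace.proj (𝕜 := ℝ) j : Conf n →L[ℝ] ℝ)) x * φ x := by
    ext x; simp [qOp_apply]
  rw [SchwartzMap.lineDerivOp_apply_eq_fderiv, h1, fderiv_fun_mul (ContinuousLinearMap.differentiableAt _)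
    φ.differentiableAt, ContinuousLinearMap.fderiv]
  simp [qOp_apply, SchwartzMap.lineDerivOp_apply_eq_fderiv]
  ring

theorem lineDerivOp_comm (v w : Conf n) (φ : Schw n) :
    LineDeriv.lineDerivOp v (LineDeriv.lineDerivOp w φ) =
      LineDeriv.lineDerivOp w (LineDeriv.lineDerivOp v φ) := by
  ext x
  have h (v w : Conf n) : LineDeriv.lineDerivOp v (LineDeriv.lineDerivOp w φ) x =
      fderiv ℝ (fderiv ℝ φ) x v w := by
    rw [SchwartzMap.lineDerivOp_apply_eq_fderiv]
    have h1 : (LineDeriv.lineDerivOp w φ : Conf n → ℂ) = fun x => fderiv ℝ φ x w := by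
      ext x; rw [SchwartzMap.lineDerivOp_apply_eq_fderiv]
    rw [h1, fderiv_clm_apply (((φ.smooth 2).fderiv_right (m := 1) (by norm_num)).differentiable
      (by norm_num) x) (differentiableAt_const w)]
    simp
  rw [h, h]
  exact ((φ.smooth 2).contDiffAt.isSymmSndFDerivAt (by simp)) v w

/-- Canonical commutation relations: commutators of canonical operators are scalars. -/
theorem exists_commutator_xOp (ħ : ℝ) (j k : Idx n) :
    ∃ c : ℂ, ∀ φ : Schw n, xOp ħ j (xOp ħ k φ) = xOp ħ k (xOp ħ j φ) + c • φ := by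
  rcases j with j | j <;> rcases k with k | k
  · refine ⟨0, fun φ => ?_⟩
    ext x
    simp [xOp, qOp_apply]
    ring
  · refine ⟨(Complex.I * ħ) * ((EuclideanSpace.single k (1 : ℝ) : Conf n) j : ℂ), fun φ => ?_⟩
    simp only [xOp, Sum.elim_inl, Sum.elim_inr, pOp_apply, lineDerivOp_qOp, map_smul]
    module
  · refine ⟨-(Complex.I * ħ) * ((EuclideanSpace.single j (1 : ℝ) : Conf n) k : ℂ), fun φ => ?_⟩
    simp only [xOp, Sum.elim_inl, Sum.elim_inr, pOp_apply, lineDerivOp_qOp, map_smul]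
    module
  · refine ⟨0, fun φ => ?_⟩
    simp only [xOp, Sum.elim_inr, pOp_apply, LineDeriv.lineDerivOp_smul]
    rw [lineDerivOp_comm]
    simp

theorem inner_toH (φ ψ : Schw n) : ⟪toH φ, toH ψ⟫_ℂ = ∫ x, ⟪φ x, ψ x⟫_ℂ := by
  rw [MeasureTheory.L2.inner_def]
  refine MeasureTheory.integral_congr_ae ?_
  filter_upwards [φ.coeFn_toLp 2 MeasureTheory.volume, ψ.coeFn_toLp 2 MeasureTheory.volume]
    with x h1 h2
  simp only [toH, SchwartzMap.toLpCLM_apply, h1, h2]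

theorem toH_injective : Function.Injective (toH : Schw n → Hilb n) :=
  SchwartzMap.injective_toLp 2 MeasureTheory.volume

theorem inner_toH_lineDerivOp (v : Conf n) (φ ψ : Schw n) :
    ⟪toH φ, toH (LineDeriv.lineDerivOp v ψ)⟫_ℂ = -⟪toH (LineDeriv.lineDerivOp v φ), toH ψ⟫_ℂ := by
  simp only [inner_toH]
  exact SchwartzMap.integral_bilinear_lineDerivOp_right_eq_neg_left φ ψ
    (isBoundedBilinearMap_inner (𝕜 := ℂ) (E := ℂ)).toContinuousLinearMap v

theorem inner_toH_xOp (ħ : ℝ) (j : Idx n) (φ ψ : Schw n) :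
    ⟪toH φ, toH (xOp ħ j ψ)⟫_ℂ = ⟪toH (xOp ħ j φ), toH ψ⟫_ℂ := by
  rcases j with j | j
  · simp only [xOp, Sum.elim_inl, inner_toH, qOp_apply]
    refine MeasureTheory.integral_congr_ae (Filter.Eventually.of_forall fun x => ?_)
    simp
    ring
  · simp only [xOp, Sum.elim_inr, pOp_apply, map_smul, inner_smul_left, inner_smul_right,
      inner_toH_lineDerivOp]
    simp

theorem quadOp_apply (ħ : ℝ) (M : Matrix (Idx n) (Idx n) ℝ) (φ : Schw n) :
    quadOp ħ M φ = (1 / 2 : ℂ) • ∑ j, ∑ k, ((M j k : ℝ) : ℂ) • xOp ħ j (xOp ħ k φ) := by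
  simp [quadOp]

theorem linOp_apply (ħ : ℝ) (c : Idx n → ℂ) (φ : Schw n) :
    linOp ħ c φ = ∑ j, c j • xOp ħ j φ := by
  simp [linOp]

theorem inner_toH_quadOp (ħ : ℝ) {M : Matrix (Idx n) (Idx n) ℝ} (hM : M.IsSymm) (φ ψ : Schw n) :
    ⟪toH φ, toH (quadOp ħ M ψ)⟫_ℂ = ⟪toH (quadOp ħ M φ), toH ψ⟫_ℂ := by
  simp only [quadOp_apply, map_smul, map_sum, inner_smul_left, inner_smul_right, inner_sum,
    sum_inner, inner_toH_xOp]
  rw [Finset.sum_comm]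
  have h2 : (starRingEnd ℂ) (1 / 2) = 1 / 2 := by simp [Complex.ext_iff]
  rw [h2]
  congr 1
  refine Finset.sum_congr rfl fun j _ => Finset.sum_congr rfl fun k _ => ?_
  rw [hM.apply, Complex.conj_ofReal]

/-! ### Spectral theory of the Hamiltonian -/

theorem IsEigen.inner_eq_zero {ħ : ℝ} {B : Matrix (Idx n) (Idx n) ℝ} (hB : B.IsSymm)
    {E E' : ℝ} {φ ψ : Schw n} (hφ : IsEigen ħ B E φ) (hψ : IsEigen ħ B E' ψ) (h : E ≠ E') :
    ⟪toH φ, toH ψ⟫_ℂ = 0 := by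
  have h1 := inner_toH_quadOp ħ hB φ ψ
  rw [hφ, hψ, map_smul, map_smul, inner_smul_left, inner_smul_right, Complex.conj_ofReal] at h1
  have h2 : ((E' : ℂ) - E) * ⟪toH φ, toH ψ⟫_ℂ = 0 := by linear_combination h1
  rcases mul_eq_zero.1 h2 with h3 | h3
  · exact absurd (by exact_mod_cast (sub_eq_zero.1 h3).symm) h
  · exact h3

/-- The relation is the vanishing of a continuous functional on pairs, so it passes from the
generators of the graph, where it is orthogonality of eigenspaces, to the closure. -/
theorem inner_eq_of_mem_expGraph {ħ : ℝ} {B : Matrix (Idx n) (Idx n) ℝ} (hB : B.IsSymm)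
    {z : ℂ} {u v : Hilb n} (h : (u, v) ∈ expGraph ħ B z) {E : ℝ} {ψ : Schw n}
    (hψ : IsEigen ħ B E ψ) : ⟪toH ψ, v⟫_ℂ = Complex.exp (z * E) * ⟪toH ψ, u⟫_ℂ := by
  let T : Hilb n × Hilb n →L[ℂ] ℂ := (innerSL ℂ (toH ψ)).comp (ContinuousLinearMap.snd ℂ _ _) -
    Complex.exp (z * E) • (innerSL ℂ (toH ψ)).comp (ContinuousLinearMap.fst ℂ _ _)
  have hT : expGraph ħ B z ≤ T.ker := by
    refine Submodule.topologicalClosure_minimal _ (Submodule.span_le.2 ?_) T.isClosed_ker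
    rintro p ⟨φ, E', hφ, rfl⟩
    by_cases hE : E = E'
    · subst hE
      simp [T, inner_smul_right]
    · simp [T, inner_smul_right, hψ.inner_eq_zero hB hφ hE]
  have h2 : T (u, v) = 0 := hT h
  simpa [T, sub_eq_zero] using h2

/-- The eigenspaces of the Hamiltonian, as subspaces of the Hilbert space. -/
def eigenspace (ħ : ℝ) (B : Matrix (Idx n) (Idx n) ℝ) (E : ℝ) : Submodule ℂ (Hilb n) :=
  (LinearMap.ker ((quadOp ħ B : Schw n →L[ℂ] Schw n).toLinearMap - (E : ℂ) • LinearMap.id)).map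
    (toH : Schw n →L[ℂ] Hilb n).toLinearMap

theorem mem_eigenspace {ħ : ℝ} {B : Matrix (Idx n) (Idx n) ℝ} {E : ℝ} {u : Hilb n} :
    u ∈ eigenspace ħ B E ↔ ∃ φ, IsEigen ħ B E φ ∧ toH φ = u := by
  simp [eigenspace, IsEigen, sub_eq_zero]

theorem orthogonalFamily_eigenspace (ħ : ℝ) {B : Matrix (Idx n) (Idx n) ℝ} (hB : B.IsSymm) :
    OrthogonalFamily ℂ (fun E => eigenspace ħ B E) fun E => (eigenspace ħ B E).subtypeₗᵢ := by
  rintro E E' hE ⟨u, hu⟩ ⟨v, hv⟩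
  obtain ⟨φ, hφ, rfl⟩ := mem_eigenspace.1 hu
  obtain ⟨ψ, hψ, rfl⟩ := mem_eigenspace.1 hv
  exact hφ.inner_eq_zero hB hψ hE

/-- `e^{-βĤ}` is everywhere defined on orthonormal bases and has a finite trace. -/
def HasTrace (ħ β : ℝ) (B : Matrix (Idx n) (Idx n) ℝ) : Prop :=
  ∀ (ι : Type) (b : HilbertBasis ι ℂ (Hilb n)), ∃ f : ι → Hilb n,
    (∀ i, (b i, f i) ∈ expGraph ħ B (-(β : ℂ))) ∧ Summable (fun i => ⟪b i, f i⟫_ℂ)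

theorem HasGNS.hasTrace {ħ β : ℝ} {B : Matrix (Idx n) (Idx n) ℝ} {c : ℂ}
    (h : HasGNS ħ β B 1 1 c) : HasTrace ħ β B := by
  intro ι b
  obtain ⟨f, hf, hs⟩ := h ι b
  refine ⟨f, fun i => ?_, hs.summable⟩
  have h1 : ContinuousLinearMap.adjoint (1 : Obs n) = 1 := ContinuousLinearMap.adjoint_id
  have := hf i
  rwa [h1] at this

variable {ħ β : ℝ} {B : Matrix (Idx n) (Idx n) ℝ}

/-- First components of `expGraph` lie in the closed span of the eigenfunctions by construction, and
the trace condition puts a whole Hilbert basis in the domain. -/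
theorem HasTrace.topologicalClosure_iSup_eigenspace (h : HasTrace ħ β B) :
    (⨆ E, eigenspace ħ B E).topologicalClosure = ⊤ := by
  have hmem : ∀ z : ℂ, ∀ p ∈ expGraph ħ B z, p.1 ∈ (⨆ E, eigenspace ħ B E).topologicalClosure := by
    intro z
    have : expGraph ħ B z ≤ (⨆ E, eigenspace ħ B E).topologicalClosure.comap
        (ContinuousLinearMap.fst ℂ (Hilb n) (Hilb n)).toLinearMap := by
      refine Submodule.topologicalClosure_minimal _ (Submodule.span_le.2 ?_) ?_
      · rintro p ⟨φ, E, hφ, rfl⟩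
        exact Submodule.le_topologicalClosure _
          (Submodule.mem_iSup_of_mem E (mem_eigenspace.2 ⟨φ, hφ, rfl⟩))
      · exact (Submodule.isClosed_topologicalClosure _).preimage continuous_fst
    exact fun p hp => this hp
  obtain ⟨w, b, -⟩ := exists_hilbertBasis ℂ (Hilb n)
  obtain ⟨f, hf, -⟩ := h w b
  rw [eq_top_iff, ← b.dense_span]
  refine Submodule.topologicalClosure_minimal _ (Submodule.span_le.2 ?_)
    (Submodule.isClosed_topologicalClosure _)
  rintro _ ⟨i, rfl⟩
  exact hmem _ _ (hf i)

/-- Every unit vector of the eigenspace contributes the same amount `exp(-βE)` to the trace, so an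
orthonormal set in it, extended to a Hilbert basis, must be finite. -/
theorem HasTrace.finiteDimensional_eigenspace (hB : B.IsSymm) (h : HasTrace ħ β B) (E : ℝ) :
    FiniteDimensional ℂ (eigenspace ħ B E) := by
  obtain ⟨w, -, hw, hmax⟩ := exists_maximal_orthonormal (orthonormal_empty ℂ (eigenspace ħ B E))
  rw [maximal_orthonormal_iff_orthogonalComplement_eq_bot hw] at hmax
  have hS : Orthonormal ℂ (Subtype.val : (Subtype.val '' w : Set (Hilb n)) → Hilb n) := by
    have h1 : Orthonormal ℂ fun x : w => ((x : eigenspace ħ B E) : Hilb n) :=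
      hw.comp_linearIsometry (eigenspace ħ B E).subtypeₗᵢ
    have h2 := h1.toSubtypeRange
    have h3 : Set.range (fun x : w => ((x : eigenspace ħ B E) : Hilb n)) = Subtype.val '' w := by
      ext; simp
    rwa [h3] at h2
  obtain ⟨W, b, hSW, hb⟩ := hS.exists_hilbertBasis_extension
  obtain ⟨f, hf, hs⟩ := h W b
  have h0 : ∀ᶠ i in Filter.cofinite, ‖⟪b i, f i⟫_ℂ‖ < Real.exp (-β * E) := by
    have := hs.tendsto_cofinite_zero.norm
    rw [norm_zero] at this
    exact this.eventually_lt_const (Real.exp_pos _)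
  have hfin : (Subtype.val '' w : Set (Hilb n)).Finite := by
    refine ((Filter.eventually_cofinite.1 h0).image (Subtype.val : W → Hilb n)).subset ?_
    intro x hx
    have hxW := hSW hx
    refine ⟨⟨x, hxW⟩, ?_, rfl⟩
    obtain ⟨⟨x', hx'⟩, -, rfl⟩ := hx
    obtain ⟨φ, hφ, rfl⟩ := mem_eigenspace.1 hx'
    have h1 := inner_eq_of_mem_expGraph hB (hf ⟨_, hxW⟩) hφ
    have h2 : b ⟨_, hxW⟩ = toH φ := by rw [hb]
    have h3 : ‖b ⟨_, hxW⟩‖ = 1 := b.orthonormal.1 _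
    simp only [Set.mem_ofPred_eq, not_lt]
    rw [h2] at h1 h3 ⊢
    rw [h1, inner_self_eq_norm_sq_to_K, h3]
    simp [Complex.norm_exp]
  have hwfin : w.Finite := hfin.of_finite_image Subtype.val_injective.injOn
  -- The eigenspace is not known to be complete, but this finite-dimensional span is, so a trivial
  -- orthogonal complement makes it everything.
  have : FiniteDimensional ℂ (Submodule.span ℂ w) := FiniteDimensional.span_of_finite ℂ hwfin
  rw [Submodule.orthogonal_eq_bot_iff] at hmax
  rw [hmax] at this
  exact Module.Finite.equiv (Submodule.topEquiv (R := ℂ) (M := eigenspace ħ B E))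

/-- A Hilbert basis of Schwartz eigenfunctions of the Hamiltonian. -/
structure EigenBasis (ħ : ℝ) (B : Matrix (Idx n) (Idx n) ℝ) (ι : Type) where
  /-- the basis vectors -/
  b : HilbertBasis ι ℂ (Hilb n)
  /-- the eigenfunctions -/
  e : ι → Schw n
  /-- the eigenvalues -/
  energy : ι → ℝ
  toH_e : ∀ i, toH (e i) = b i
  isEigen : ∀ i, IsEigen ħ B (energy i) (e i)

theorem _root_.OrthogonalFamily.exists_orthonormal_of_finiteDimensional {H κ : Type*}
    [NormedAddCommGroup H] [InnerProductSpace ℂ H] {V : κ → Submodule ℂ H}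
    [∀ k, FiniteDimensional ℂ (V k)]
    (hV : OrthogonalFamily ℂ (fun k => V k) fun k => (V k).subtypeₗᵢ) :
    ∃ v : (Σ k, Fin (Module.finrank ℂ (V k))) → H, Orthonormal ℂ v ∧
      (⨆ k, V k) ≤ Submodule.span ℂ (Set.range v) ∧ ∀ i, v i ∈ V i.1 := by
  refine ⟨fun i => (stdOrthonormalBasis ℂ (V i.1) i.2 : H),
    hV.orthonormal_sigma_orthonormal fun k => (stdOrthonormalBasis ℂ (V k)).orthonormal, ?_,
    fun i => Subtype.prop _⟩
  refine iSup_le fun k u hu => ?_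
  have h1 : (⟨u, hu⟩ : V k) ∈ Submodule.span ℂ (Set.range (stdOrthonormalBasis ℂ (V k))) := by
    rw [← OrthonormalBasis.coe_toBasis, Module.Basis.span_eq]; trivial
  have h2 := Submodule.mem_map_of_mem (f := (V k).subtype) h1
  rw [Submodule.map_span] at h2
  refine Submodule.span_mono ?_ h2
  rintro _ ⟨_, ⟨i, rfl⟩, rfl⟩
  exact ⟨⟨k, i⟩, rfl⟩

theorem HasTrace.exists_orthonormal (hB : B.IsSymm) (h : HasTrace ħ β B) :
    ∃ (ι : Type) (v : ι → Hilb n) (E : ι → ℝ), Orthonormal ℂ v ∧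
      ⊤ ≤ (Submodule.span ℂ (Set.range v)).topologicalClosure ∧
      ∀ i, v i ∈ eigenspace ħ B (E i) := by
  have := h.finiteDimensional_eigenspace hB
  obtain ⟨v, hv, hd, hE⟩ :=
    (orthogonalFamily_eigenspace ħ hB).exists_orthonormal_of_finiteDimensional
  exact ⟨_, v, fun i => i.1, hv, h.topologicalClosure_iSup_eigenspace.symm.le.trans
    (Submodule.topologicalClosure_mono hd), hE⟩

theorem HasTrace.exists_eigenBasis (hB : B.IsSymm) (h : HasTrace ħ β B) :
    ∃ (ι : Type) (b : EigenBasis ħ B ι), Summable fun i => Real.exp (-β * b.energy i) := by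
  obtain ⟨ι, v, E, hv, hd, hE⟩ := h.exists_orthonormal hB
  choose e he1 he2 using fun i => mem_eigenspace.1 (hE i)
  have hb : ∃ b : EigenBasis ħ B ι, b.energy = E :=
    ⟨⟨HilbertBasis.mk hv hd, e, E, fun i => by rw [he2, HilbertBasis.coe_mk], he1⟩, rfl⟩
  obtain ⟨b, -⟩ := hb
  refine ⟨ι, b, ?_⟩
  obtain ⟨f, hf, hs⟩ := h ι b.b
  refine hs.norm.congr fun i => ?_
  have h1 := inner_eq_of_mem_expGraph hB (hf i) (b.isEigen i)
  rw [b.toH_e, inner_self_eq_norm_sq_to_K, b.b.orthonormal.1] at h1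
  rw [h1]
  simp [Complex.norm_exp]

/-! ### Exponentials and the modular group in an eigenbasis -/

namespace EigenBasis
variable {ι : Type} (b : EigenBasis ħ B ι)

theorem mem_expGraph_iff (hB : B.IsSymm) {z : ℂ} {u v : Hilb n} :
    (u, v) ∈ expGraph ħ B z ↔
      ∀ i, ⟪b.b i, v⟫_ℂ = Complex.exp (z * b.energy i) * ⟪b.b i, u⟫_ℂ := by
  constructor
  · intro h i
    rw [← b.toH_e]
    exact inner_eq_of_mem_expGraph hB h (b.isEigen i)
  · intro h
    -- The partial sums of both expansions converge jointly to `(u, v)`, and each of them lies in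
    -- the graph.
    have h1 := (b.b.hasSum_repr u).prodMk (b.b.hasSum_repr v)
    refine (Submodule.isClosed_topologicalClosure _).mem_of_tendsto h1
      (Filter.Eventually.of_forall fun s => Submodule.sum_mem _ fun i _ => ?_)
    have h2 : (b.b.repr u i • b.b i, b.b.repr v i • b.b i) =
        b.b.repr u i • (toH (b.e i), Complex.exp (z * b.energy i) • toH (b.e i)) := by
      simp only [HilbertBasis.repr_apply_apply, h, Prod.smul_mk, b.toH_e, smul_smul, mul_comm]
    rw [h2]
    exact Submodule.smul_mem _ _ (Submodule.le_topologicalClosure _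
      (Submodule.subset_span ⟨_, _, b.isEigen i, rfl⟩))

/-- This turns the domain condition on unbounded exponentials into a scalar condition on matrix
elements. Boundedness of `A` and `A'` allows the converse to be summed over the expansion of `(u,
v)`. -/
theorem isModular_iff (hB : B.IsSymm) {z : ℂ} {A A' : Obs n} :
    IsModular ħ B z A A' ↔ ∀ i j, ⟪b.b i, A' (b.b j)⟫_ℂ =
      Complex.exp (Complex.I * z / ħ * ((b.energy i : ℂ) - b.energy j)) * ⟪b.b i, A (b.b j)⟫_ℂ := by
  constructor
  · intro h i j
    have h1 : (b.b j, Complex.exp (-(Complex.I * z / ħ) * b.energy j) • b.b j) ∈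
        expGraph ħ B (-(Complex.I * z / ħ)) := by
      rw [← b.toH_e]
      exact Submodule.le_topologicalClosure _ (Submodule.subset_span ⟨_, _, b.isEigen j, rfl⟩)
    have h2 := (b.mem_expGraph_iff hB).1 (h _ _ h1) i
    rw [h2, map_smul, inner_smul_right, ← mul_assoc, ← Complex.exp_add]
    ring_nf
  · intro h u v huv
    rw [b.mem_expGraph_iff hB]
    intro i
    let T : Hilb n × Hilb n →L[ℂ] ℂ :=
      ((innerSL ℂ (b.b i)).comp A').comp (ContinuousLinearMap.fst ℂ _ _) -
      Complex.exp (Complex.I * z / ħ * b.energy i) •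
        ((innerSL ℂ (b.b i)).comp A).comp (ContinuousLinearMap.snd ℂ _ _)
    have key : ∀ (j : ι), T (b.b j, Complex.exp (-(Complex.I * z / ħ) * b.energy j) • b.b j) = 0 := by
      intro j
      simp only [T, sub_apply, smul_apply,
        ContinuousLinearMap.comp_apply, ContinuousLinearMap.coe_fst', ContinuousLinearMap.coe_snd',
        innerSL_apply_apply, map_smul, smul_eq_mul, h]
      rw [← mul_assoc, ← Complex.exp_add]
      ring_nf
    have h1 := (b.mem_expGraph_iff hB).1 huv
    have h2 := ((b.b.hasSum_repr u).prodMk (b.b.hasSum_repr v)).mapL T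
    have h3 : ∀ j, T (b.b.repr u j • b.b j, b.b.repr v j • b.b j) = 0 := by
      intro j
      have : (b.b.repr u j • b.b j, b.b.repr v j • b.b j) =
        b.b.repr u j • (b.b j, Complex.exp (-(Complex.I * z / ħ) * b.energy j) • b.b j) := by
        simp only [HilbertBasis.repr_apply_apply, h1, Prod.smul_mk, smul_smul, mul_comm]
      rw [this, map_smul, key, smul_zero]
    simp only [h3] at h2
    have h4 : T (u, v) = 0 := h2.unique hasSum_zero
    simpa [T, sub_eq_zero] using h4

end EigenBasis

/-! ### Quantum dynamical semigroups -/

/-- Complete positivity for the pair `(1, A)` makes a sum real whose diagonal terms are already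
real. The cross terms then have no imaginary part, and replacing `x` by `ix` yields the other half
of the identity. -/
theorem IsQDS.adjoint {Λ : ℝ → (Obs n →ₗ[ℂ] Obs n)} (hΛ : IsQDS Λ) {t : ℝ} (ht : 0 ≤ t)
    (A : Obs n) :
    Λ t (ContinuousLinearMap.adjoint A) = ContinuousLinearMap.adjoint (Λ t A) := by
  have h1 : ContinuousLinearMap.adjoint (1 : Obs n) = 1 := ContinuousLinearMap.adjoint_id
  have hdiag : ∀ (X : Obs n) (x : Hilb n),
      (⟪x, Λ t ((ContinuousLinearMap.adjoint X).comp X) x⟫_ℂ).im = 0 := by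
    intro X x
    have := hΛ.completelyPositive t ht 1 ![X] ![x]
    simp only [Finset.univ_unique, Finset.sum_singleton] at this
    exact (Complex.le_def.1 this).2.symm
  have him : ∀ x y : Hilb n, (⟪x, Λ t A y⟫_ℂ + ⟪y, Λ t (ContinuousLinearMap.adjoint A) x⟫_ℂ).im
      = 0 := by
    intro x y
    have h2 := (Complex.le_def.1 (hΛ.completelyPositive t ht 2 ![1, A] ![x, y])).2
    have h3 := hdiag 1 x
    have h4 := hdiag A y
    have h5 : (1 : Obs n).comp A = A := ContinuousLinearMap.id_comp A
    have h6 : (ContinuousLinearMap.adjoint A).comp (1 : Obs n) = ContinuousLinearMap.adjoint A :=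
      ContinuousLinearMap.comp_id _
    simp only [Fin.sum_univ_two, Matrix.cons_val_zero, Matrix.cons_val_one, h1, h5, h6,
      Complex.add_im, Complex.zero_im] at h2 h3 h4 ⊢
    linarith
  refine ContinuousLinearMap.ext fun x => ext_inner_left ℂ fun y => ?_
  rw [ContinuousLinearMap.adjoint_inner_right, ← inner_conj_symm (Λ t A y) x]
  have h2 := him x y
  have h3 := him (Complex.I • x) y
  simp only [map_smul, inner_smul_left, inner_smul_right, Complex.conj_I, neg_mul,
    Complex.add_im, Complex.neg_im, Complex.I_mul_im] at h3
  apply Complex.ext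
  · simp only [Complex.conj_re]
    linarith
  · simp only [Complex.conj_im]
    rw [Complex.add_im] at h2
    linarith

/-! ### Matrix units, detailed balance and Bohr frequencies -/

namespace EigenBasis
variable {ι : Type} (b : EigenBasis ħ B ι)

/-- The matrix units of an eigenbasis. -/
def unit (k l : ι) : Obs n := InnerProductSpace.rankOne ℂ (b.b k) (b.b l)

theorem unit_apply (k l : ι) (v : Hilb n) : b.unit k l v = ⟪b.b l, v⟫_ℂ • b.b k := by
  simp [unit]

theorem adjoint_unit (k l : ι) : ContinuousLinearMap.adjoint (b.unit k l) = b.unit l k := by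
  simp [unit]

theorem inner_eq_ite [DecidableEq ι] (i j : ι) : ⟪b.b i, b.b j⟫_ℂ = if i = j then 1 else 0 :=
  orthonormal_iff_ite.1 b.b.orthonormal i j

/-- The Boltzmann weights. -/
def weight (b : EigenBasis ħ B ι) (β : ℝ) (i : ι) : ℝ := Real.exp (-β * b.energy i)

theorem hasSum_of_hasGNS (hB : B.IsSymm) {A C : Obs n} {c : ℂ} (h : HasGNS ħ β B A C c) :
    HasSum (fun i => (b.weight β i : ℂ) * ⟪A (b.b i), C (b.b i)⟫_ℂ) c := by
  obtain ⟨f, hf, hs⟩ := h ι b.b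
  refine hs.congr_fun fun i => ?_
  rw [(b.mem_expGraph_iff hB).1 (hf i) i, ContinuousLinearMap.adjoint_inner_right, weight]
  push_cast
  rfl

theorem hasGNS_unit_left (hB : B.IsSymm) {i j : ι} {C : Obs n} {c : ℂ}
    (h : HasGNS ħ β B (b.unit i j) C c) :
    c = (b.weight β j : ℂ) * ⟪b.b i, C (b.b j)⟫_ℂ := by
  classical
  refine (b.hasSum_of_hasGNS hB h).unique ?_
  convert hasSum_single (f := fun m => (b.weight β m : ℂ) * ⟪b.unit i j (b.b m), C (b.b m)⟫_ℂ) j ?_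
    using 1
  · simp only [unit_apply, inner_eq_ite, if_true, one_smul]
  · intro m hm
    simp [unit_apply, inner_eq_ite, hm.symm]

theorem hasGNS_unit_right (hB : B.IsSymm) {k l : ι} {A : Obs n} {c : ℂ}
    (h : HasGNS ħ β B A (b.unit k l) c) :
    c = (b.weight β l : ℂ) * ⟪A (b.b l), b.b k⟫_ℂ := by
  classical
  refine (b.hasSum_of_hasGNS hB h).unique ?_
  convert hasSum_single (f := fun m => (b.weight β m : ℂ) * ⟪A (b.b m), b.unit k l (b.b m)⟫_ℂ) l ?_
    using 1
  · simp only [unit_apply, inner_eq_ite, if_true, one_smul]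
  · intro m hm
    simp [unit_apply, inner_eq_ite, hm.symm]

/-- Detailed balance forbids transitions between matrix units of different Bohr frequencies. -/
theorem inner_map_unit_eq_zero (hB : B.IsSymm) (hβ : 0 < β) {Λ : ℝ → (Obs n →ₗ[ℂ] Obs n)}
    (hΛ : IsQDS Λ) (hDB : DetailedBalance ħ β B Λ) {t : ℝ} (ht : 0 ≤ t) {i j k l : ι}
    (h : b.energy i - b.energy j ≠ b.energy k - b.energy l) :
    ⟪b.b i, Λ t (b.unit k l) (b.b j)⟫_ℂ = 0 := by
  have key : ∀ i j k l : ι, (b.weight β j : ℂ) * ⟪b.b i, Λ t (b.unit k l) (b.b j)⟫_ℂ =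
      (b.weight β l : ℂ) * ⟪Λ t (b.unit i j) (b.b l), b.b k⟫_ℂ := by
    intro i j k l
    obtain ⟨c, h1, h2⟩ := hDB t ht (b.unit i j) (b.unit k l)
    exact (b.hasGNS_unit_left hB h2).symm.trans (b.hasGNS_unit_right hB h1)
  have hadj : ∀ i j k l : ι, ⟪b.b i, Λ t (b.unit k l) (b.b j)⟫_ℂ =
      ⟪Λ t (b.unit l k) (b.b i), b.b j⟫_ℂ := by
    intro i j k l
    rw [← b.adjoint_unit l k, hΛ.adjoint ht, ContinuousLinearMap.adjoint_inner_right]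
  have h1 := key i j k l
  -- The second linear relation between the same two unknowns, obtained from the adjoint matrix
  -- units.
  have h2 := congrArg (starRingEnd ℂ) (key j i l k)
  simp only [map_mul, Complex.conj_ofReal, inner_conj_symm] at h2
  rw [← hadj i j k l, hadj l k j i] at h2
  have h3 : ((b.weight β j * b.weight β k - b.weight β i * b.weight β l : ℝ) : ℂ) *
      ⟪b.b i, Λ t (b.unit k l) (b.b j)⟫_ℂ = 0 := by
    push_cast
    linear_combination (b.weight β k : ℂ) * h1 - (b.weight β l : ℂ) * h2
  refine (mul_eq_zero.1 h3).resolve_left fun h4 => h ?_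
  have h5 := sub_eq_zero.1 (Complex.ofReal_eq_zero.1 h4)
  simp only [weight, ← Real.exp_add, Real.exp_eq_exp] at h5
  have h6 : β * ((b.energy i - b.energy j) - (b.energy k - b.energy l)) = 0 := by linarith
  exact sub_eq_zero.1 ((mul_eq_zero.1 h6).resolve_left hβ.ne')

theorem inner_eq_zero_of_forall {φ ψ : Hilb n} {X : Obs n}
    (h : ∀ i j, ⟪φ, b.b i⟫_ℂ ≠ 0 → ⟪b.b j, ψ⟫_ℂ ≠ 0 → ⟪b.b i, X (b.b j)⟫_ℂ = 0) :
    ⟪φ, X ψ⟫_ℂ = 0 := by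
  have h1 := (b.b.hasSum_repr ψ).mapL ((innerSL ℂ φ).comp X)
  refine h1.unique ?_
  convert hasSum_zero with j
  simp only [map_smul, HilbertBasis.repr_apply_apply, smul_eq_mul, mul_eq_zero]
  by_cases hj : ⟪b.b j, ψ⟫_ℂ = 0
  · exact Or.inl hj
  right
  have h2 := (b.b.hasSum_repr (X (b.b j))).mapL (innerSL ℂ φ)
  refine h2.unique ?_
  convert hasSum_zero with i
  simp only [map_smul, HilbertBasis.repr_apply_apply, smul_eq_mul, mul_eq_zero, innerSL_apply_apply]
  by_cases hi : ⟪φ, b.b i⟫_ℂ = 0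
  · exact Or.inr hi
  · exact Or.inl (h i j hi hj)

/-- An arbitrary eigenfunction overlaps only with basis vectors of its own energy, so the selection
rule does not depend on the basis chosen inside an eigenspace. -/
theorem matEl_map_unit_eq_zero (hB : B.IsSymm) (hβ : 0 < β) {Λ : ℝ → (Obs n →ₗ[ℂ] Obs n)}
    (hΛ : IsQDS Λ) (hDB : DetailedBalance ħ β B Λ) {t : ℝ} (ht : 0 ≤ t) {k l : ι}
    {E E' : ℝ} {φ ψ : Schw n} (hφ : IsEigen ħ B E φ) (hψ : IsEigen ħ B E' ψ)
    (h : E - E' ≠ b.energy k - b.energy l) :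
    matEl (Λ t (b.unit k l)) φ ψ = 0 := by
  refine b.inner_eq_zero_of_forall fun i j hi hj => ?_
  have h1 : E = b.energy i := by
    by_contra h2
    exact hi (by rw [← b.toH_e]; exact hφ.inner_eq_zero hB (b.isEigen i) h2)
  have h3 : b.energy j = E' := by
    by_contra h2
    exact hj (by rw [← b.toH_e]; exact (b.isEigen j).inner_eq_zero hB hψ h2)
  subst h1 h3
  exact b.inner_map_unit_eq_zero hB hβ hΛ hDB ht h

/-! ### Finite truncations of bounded operators -/

/-- The orthogonal projection onto the span of finitely many basis vectors. -/
def proj (s : Finset ι) : Obs n := ∑ k ∈ s, b.unit k k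

theorem proj_apply (s : Finset ι) (v : Hilb n) :
    b.proj s v = ∑ k ∈ s, ⟪b.b k, v⟫_ℂ • b.b k := by
  simp [proj, unit_apply]

theorem inner_proj_left (s : Finset ι) (u v : Hilb n) :
    ⟪b.proj s u, v⟫_ℂ = ⟪u, b.proj s v⟫_ℂ := by
  simp only [proj_apply, sum_inner, inner_sum, inner_smul_left, inner_smul_right, inner_conj_symm]
  exact Finset.sum_congr rfl fun k _ => mul_comm _ _

theorem norm_proj_le (s : Finset ι) : ‖b.proj s‖ ≤ 1 := by
  refine ContinuousLinearMap.opNorm_le_bound _ zero_le_one fun v => ?_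
  have h1 : b.proj s (b.proj s v) = b.proj s v := by
    rw [proj_apply, proj_apply]
    exact Finset.sum_congr rfl fun k hk => by rw [b.b.orthonormal.inner_right_sum _ hk]
  -- For a self-adjoint idempotent, `‖Pv‖² = ⟨Pv, v⟩`.
  have h2 : ‖b.proj s v‖ ^ 2 ≤ ‖b.proj s v‖ * ‖v‖ := by
    have := norm_inner_le_norm (𝕜 := ℂ) (b.proj s v) v
    rw [← h1, inner_proj_left, inner_self_eq_norm_sq_to_K] at this
    simpa [h1] using this
  rcases (norm_nonneg (b.proj s v)).eq_or_lt with h3 | h3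
  · rw [← h3]; positivity
  · nlinarith

theorem tendsto_proj (v : Hilb n) :
    Filter.Tendsto (fun s => b.proj s v) Filter.atTop (nhds v) := by
  have := b.b.hasSum_repr v
  simpa only [HasSum, HilbertBasis.repr_apply_apply, ← proj_apply,
    SummationFilter.unconditional_filter] using this

theorem proj_comp_comp_proj (s : Finset ι) (A : Obs n) :
    (b.proj s).comp (A.comp (b.proj s)) =
      ∑ k ∈ s, ∑ l ∈ s, ⟪b.b k, A (b.b l)⟫_ℂ • b.unit k l := by
  ext1 v
  have h : A (b.proj s v) = ∑ l ∈ s, ⟪b.b l, v⟫_ℂ • A (b.b l) := by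
    simp only [proj_apply, map_sum, map_smul]
  simp only [ContinuousLinearMap.comp_apply, h, b.proj_apply s (Finset.sum _ _), inner_sum,
    inner_smul_right, Finset.sum_smul, sum_apply, smul_apply, unit_apply, smul_smul]
  exact Finset.sum_congr rfl fun k _ => Finset.sum_congr rfl fun l _ => by rw [mul_comm]

/-- Normal maps are determined by their values on the matrix units. -/
theorem tendsto_sum_map_unit {Λ : ℝ → (Obs n →ₗ[ℂ] Obs n)} (hΛ : IsQDS Λ) {t : ℝ} (ht : 0 ≤ t)
    (A : Obs n) (u v : Hilb n) :
    Filter.Tendsto (fun s : Finset ι => ∑ k ∈ s, ∑ l ∈ s,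
      ⟪b.b k, A (b.b l)⟫_ℂ * ⟪u, Λ t (b.unit k l) v⟫_ℂ) Filter.atTop (nhds ⟪u, Λ t A v⟫_ℂ) := by
  have h := hΛ.normal t ht (Finset ι) Filter.atTop
    (fun s => (b.proj s).comp (A.comp (b.proj s))) A ‖A‖ ?_ ?_ u v
  · simpa only [proj_comp_comp_proj, map_sum, map_smul, sum_apply, smul_apply, inner_sum,
      inner_smul_right] using h
  · intro s
    refine (ContinuousLinearMap.opNorm_comp_le _ _).trans ?_
    refine (mul_le_of_le_one_left (norm_nonneg _) (b.norm_proj_le s)).trans ?_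
    exact (ContinuousLinearMap.opNorm_comp_le _ _).trans
      (mul_le_of_le_one_right (norm_nonneg _) (b.norm_proj_le s))
  · intro u v
    simp only [ContinuousLinearMap.comp_apply, ← inner_proj_left]
    exact (b.tendsto_proj u).inner ((A.continuous.tendsto v).comp (b.tendsto_proj v))

/-- Term by term in the truncated expansion, either the Bohr frequencies agree and so do the phase
factors, or the matrix element of `Λ t` vanishes. -/
theorem isModular_map (b : EigenBasis ħ B ι) (hB : B.IsSymm) (hβ : 0 < β) {Λ : ℝ → (Obs n →ₗ[ℂ] Obs n)}
    (hΛ : IsQDS Λ) (hDB : DetailedBalance ħ β B Λ) {t : ℝ} (ht : 0 ≤ t) {z : ℂ} {A A' : Obs n}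
    (h : IsModular ħ B z A A') : IsModular ħ B z (Λ t A) (Λ t A') := by
  rw [b.isModular_iff hB] at h ⊢
  intro i j
  refine tendsto_nhds_unique (b.tendsto_sum_map_unit hΛ ht A' (b.b i) (b.b j)) ?_
  convert (b.tendsto_sum_map_unit hΛ ht A (b.b i) (b.b j)).const_mul _ using 2 with s
  rw [Finset.mul_sum]
  refine Finset.sum_congr rfl fun k _ => ?_
  rw [Finset.mul_sum]
  refine Finset.sum_congr rfl fun l _ => ?_
  rw [h]
  by_cases hE : b.energy i - b.energy j = b.energy k - b.energy l
  · have : (b.energy i : ℂ) - b.energy j = b.energy k - b.energy l := by exact_mod_cast hE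
    rw [this]; ring
  · rw [b.inner_map_unit_eq_zero hB hβ hΛ hDB ht hE]; ring

theorem isModularForm_of_isEvolved (b : EigenBasis ħ B ι) (hB : B.IsSymm) (hβ : 0 < β) {Λ : ℝ → (Obs n →ₗ[ℂ] Obs n)}
    (hΛ : IsQDS Λ) (hDB : DetailedBalance ħ β B Λ) {t : ℝ} (ht : 0 ≤ t) {z : ℂ}
    {F F' G G' : Schw n → Schw n → ℂ} (h : IsModularForm ħ B z F F')
    (hG : IsEvolved ħ B (Λ t) F G) (hG' : IsEvolved ħ B (Λ t) F' G') :
    IsModularForm ħ B z G G' := by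
  intro E E' φ ψ hφ hψ
  refine (hG' ι b.b b.e b.energy b.toH_e b.isEigen φ ψ).unique ?_
  refine ((hG ι b.b b.e b.energy b.toH_e b.isEigen φ ψ).mul_left _).congr_fun fun p => ?_
  rw [h _ _ _ _ (b.isEigen p.1) (b.isEigen p.2)]
  change _ * matEl (Λ t (b.unit p.1 p.2)) φ ψ = _ * (_ * matEl (Λ t (b.unit p.1 p.2)) φ ψ)
  by_cases hE : E - E' = b.energy p.1 - b.energy p.2
  · have : (E : ℂ) - E' = b.energy p.1 - b.energy p.2 := by exact_mod_cast hE
    rw [this]; ring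
  · rw [b.matEl_map_unit_eq_zero hB hβ hΛ hDB ht hφ hψ hE]; ring

end EigenBasis

/-! ### The infinitesimal generator -/

/-- Uniform boundedness twice: for the functionals `⟪X k v, ·⟫` at fixed `v`, then for the
operators. -/
theorem exists_norm_le_of_inner_bounded {H κ : Type*} [NormedAddCommGroup H]
    [InnerProductSpace ℂ H] [CompleteSpace H] (X : κ → H →L[ℂ] H)
    (h : ∀ u v, ∃ C, ∀ k, ‖⟪u, X k v⟫_ℂ‖ ≤ C) : ∃ M, ∀ k, ‖X k‖ ≤ M := by
  refine banach_steinhaus fun v => ?_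
  obtain ⟨C, hC⟩ := banach_steinhaus (g := fun k => innerSL ℂ (X k v)) fun u => by
    obtain ⟨C, hC⟩ := h u v
    refine ⟨C, fun k => ?_⟩
    rw [innerSL_apply_apply, norm_inner_symm]
    exact hC k
  exact ⟨C, fun k => by simpa using hC k⟩

/-- Weak convergence on a dense set of vectors, for a bounded family of operators. -/
theorem tendsto_inner_of_dense {H κ : Type*} [NormedAddCommGroup H] [InnerProductSpace ℂ H]
    {f : Filter κ} {X : κ → H →L[ℂ] H} {X₀ : H →L[ℂ] H} {M : ℝ} (hM : ∀ k, ‖X k‖ ≤ M)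
    {S : Set H} (hS : Dense S)
    (h : ∀ u ∈ S, ∀ v ∈ S, Filter.Tendsto (fun k => ⟪u, X k v⟫_ℂ) f (nhds ⟪u, X₀ v⟫_ℂ))
    (u v : H) : Filter.Tendsto (fun k => ⟪u, X k v⟫_ℂ) f (nhds ⟪u, X₀ v⟫_ℂ) := by
  have hlip : ∀ u k x, ‖⟪u, X k x⟫_ℂ‖ ≤ ‖u‖ * M * ‖x‖ := fun u k x => by
    refine (norm_inner_le_norm _ _).trans ?_
    rw [mul_assoc]
    gcongr
    exact (X k).le_of_opNorm_le (hM k) x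
  have h1 : ∀ u ∈ S, ∀ v, Filter.Tendsto (fun k => ⟪u, X k v⟫_ℂ) f (nhds ⟪u, X₀ v⟫_ℂ) := by
    intro u hu
    have heq : Equicontinuous fun k (x : H) => ⟪u, X k x⟫_ℂ := by
      refine Metric.equicontinuous_of_continuity_modulus (fun r => ‖u‖ * M * r) ?_ _ ?_
      · simpa using (continuous_const.mul continuous_id).tendsto (0 : ℝ) (f := fun r => ‖u‖ * M * r)
      · intro x y k
        rw [dist_eq_norm, dist_eq_norm, ← inner_sub_right, ← map_sub]
        exact hlip _ _ _
    exact fun v => (heq.isClosed_setOfPred_tendsto (f := fun x => ⟪u, X₀ x⟫_ℂ)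
      (by fun_prop)).closure_subset_iff.2 (h u hu) (hS v)
  have heq : Equicontinuous fun k (x : H) => ⟪x, X k v⟫_ℂ := by
    refine Metric.equicontinuous_of_continuity_modulus (fun r => r * (M * ‖v‖)) ?_ _ ?_
    · simpa using (continuous_id.mul continuous_const).tendsto (0 : ℝ) (f := fun r => r * (M * ‖v‖))
    · intro x y k
      rw [dist_eq_norm, dist_eq_norm, ← inner_sub_left]
      refine (hlip _ _ _).trans_eq ?_
      ring
  exact (heq.isClosed_setOfPred_tendsto (f := fun x => ⟪x, X₀ v⟫_ℂ)
      (by fun_prop)).closure_subset_iff.2 (fun u hu => h1 u hu v) (hS u)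

theorem norm_le_of_inner_le_of_dense {H : Type*} [NormedAddCommGroup H] [InnerProductSpace ℂ H]
    {X : H →L[ℂ] H} {C : ℝ} (hC : 0 ≤ C) {S : Set H} (hS : Dense S)
    (h : ∀ u ∈ S, ∀ v ∈ S, ‖⟪u, X v⟫_ℂ‖ ≤ C * ‖u‖ * ‖v‖) : ‖X‖ ≤ C := by
  have h1 : ∀ u ∈ S, ∀ v, ‖⟪u, X v⟫_ℂ‖ ≤ C * ‖u‖ * ‖v‖ := fun u hu v =>
    (isClosed_le (f := fun v => ‖⟪u, X v⟫_ℂ‖) (g := fun v => C * ‖u‖ * ‖v‖) (by fun_prop)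
      (by fun_prop)).closure_subset_iff.2 (h u hu) (hS v)
  have h2 : ∀ u v, ‖⟪u, X v⟫_ℂ‖ ≤ C * ‖u‖ * ‖v‖ := fun u v =>
    (isClosed_le (f := fun u => ‖⟪u, X v⟫_ℂ‖) (g := fun u => C * ‖u‖ * ‖v‖) (by fun_prop)
      (by fun_prop)).closure_subset_iff.2 (fun u hu => h1 u hu v) (hS u)
  refine X.opNorm_le_bound hC fun v => ?_
  have h3 := h2 (X v) v
  rw [inner_self_eq_norm_sq_to_K] at h3
  have h4 : ‖X v‖ ^ 2 ≤ C * ‖X v‖ * ‖v‖ := by simpa using h3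
  rcases (norm_nonneg (X v)).eq_or_lt with h5 | h5
  · rw [← h5]; positivity
  · nlinarith

/-- By the semigroup law the difference quotient at `s` is `Λ s` applied to the one at `0`, and
normality lets the weak limit through. -/
theorem IsQDS.hasDerivWithinAt {Λ : ℝ → (Obs n →ₗ[ℂ] Obs n)} (hΛ : IsQDS Λ) {A C : Obs n}
    (hA : IsGen Λ A C) {s : ℝ} (hs : 0 ≤ s) (u v : Hilb n) :
    HasDerivWithinAt (fun r => ⟪u, Λ r A v⟫_ℂ) ⟪u, Λ s C v⟫_ℂ (Set.Ici s) s := by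
  rw [← hasDerivWithinAt_Ioi_iff_Ici, hasDerivWithinAt_iff_tendsto_slope' (by simp)]
  -- Normality requires a norm bound, which uniform boundedness supplies along a weakly convergent
  -- sequence.
  refine Filter.tendsto_of_seq_tendsto fun r hr => ?_
  have hr2 : Filter.Tendsto (fun m => r m - s) Filter.atTop (nhdsWithin 0 (Set.Ioi 0)) := by
    rw [tendsto_nhdsWithin_iff] at hr ⊢
    refine ⟨?_, hr.2.mono fun m hm => Set.mem_Ioi.2 (sub_pos.2 hm)⟩
    simpa using hr.1.sub_const s
  let X : ℕ → Obs n := fun m => (((r m - s : ℝ) : ℂ))⁻¹ • (Λ (r m - s) A - A)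
  have hX : ∀ u v, Filter.Tendsto (fun m => ⟪u, X m v⟫_ℂ) Filter.atTop (nhds ⟪u, C v⟫_ℂ) := by
    intro u v
    refine ((hA u v).comp hr2).congr fun m => ?_
    simp only [X, Function.comp_apply, smul_apply, inner_smul_right]
  obtain ⟨M, hM⟩ := exists_norm_le_of_inner_bounded X fun u v => by
    obtain ⟨C, hC⟩ := (hX u v).norm.bddAbove_range
    exact ⟨C, fun k => hC ⟨k, rfl⟩⟩
  refine (hΛ.normal s hs ℕ Filter.atTop X C M hM hX u v).congr' ?_
  filter_upwards [(tendsto_nhdsWithin_iff.1 hr).2] with m hm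
  have h1 : Λ (r m) A = Λ s (Λ (r m - s) A) := by
    have := hΛ.add s (r m - s) hs (sub_pos.2 hm).le
    rw [add_sub_cancel] at this
    rw [this, LinearMap.comp_apply]
  simp only [Function.comp_apply, slope_fun_def, X, map_smul, smul_apply, inner_smul_right,
    map_sub, sub_apply, inner_sub_right, h1, vsub_eq_sub, Complex.real_smul, Complex.ofReal_inv,
    Complex.ofReal_sub]

theorem IsQDS.exists_norm_map_le {Λ : ℝ → (Obs n →ₗ[ℂ] Obs n)} (hΛ : IsQDS Λ) (X : Obs n) :
    ∃ M, ∀ s ∈ Set.Icc (0 : ℝ) 1, ‖Λ s X‖ ≤ M := by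
  obtain ⟨M, hM⟩ := exists_norm_le_of_inner_bounded (fun s : Set.Icc (0 : ℝ) 1 => Λ s X)
    fun u v => by
      obtain ⟨C, hC⟩ := isCompact_Icc.exists_bound_of_continuousOn
        ((hΛ.continuous X u v).mono Set.Icc_subset_Ici_self)
      exact ⟨C, fun s => hC s s.2⟩
  exact ⟨M, fun s hs => hM ⟨s, hs⟩⟩

/-- A bounded operator is in the domain of the generator as soon as its matrix elements in a dense
subspace satisfy the master equation. -/
theorem IsQDS.isGen_of_dense {Λ : ℝ → (Obs n →ₗ[ℂ] Obs n)} (hΛ : IsQDS Λ) {A C : Obs n}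
    {S : Set (Hilb n)} (hS : Dense S)
    (h : ∀ u ∈ S, ∀ v ∈ S, ∀ s, 0 ≤ s →
      HasDerivWithinAt (fun r => ⟪u, Λ r A v⟫_ℂ) ⟪u, Λ s C v⟫_ℂ (Set.Ici s) s) :
    IsGen Λ A C := by
  obtain ⟨M, hM⟩ := hΛ.exists_norm_map_le C
  have hM0 : 0 ≤ M := (norm_nonneg _).trans (hM 0 (by simp))
  let D : Set.Ioc (0 : ℝ) 1 → Obs n := fun t => ((t : ℝ) : ℂ)⁻¹ • (Λ t A - A)
  have hD : ∀ t, ‖D t‖ ≤ M := by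
    rintro ⟨t, ht0, ht1⟩
    refine norm_le_of_inner_le_of_dense hM0 hS fun u hu v hv => ?_
    -- The mean value inequality bounds all difference quotients with `0 < t ≤ 1` by `M`;
    -- convergence on a dense set then suffices.
    have h1 := norm_image_sub_le_of_norm_deriv_right_le_segment (a := 0) (b := t)
      (C := ‖u‖ * (M * ‖v‖))
      ((hΛ.continuous A u v).mono Set.Icc_subset_Ici_self) (fun s hs => h u hu v hv s hs.1)
      (fun s hs => (norm_inner_le_norm _ _).trans (by
        gcongr
        exact (Λ s C).le_of_opNorm_le (hM s ⟨hs.1, hs.2.le.trans ht1⟩) v)) t ⟨ht0.le, le_rfl⟩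
    simp only [hΛ.zero, LinearMap.id_apply, sub_zero, ← inner_sub_right] at h1
    simp only [D, smul_apply, inner_smul_right, norm_mul, norm_inv, Complex.norm_real,
      Real.norm_eq_abs, abs_of_pos ht0, sub_apply]
    rw [inv_mul_le_iff₀ ht0]
    linarith
  have hlim : ∀ u ∈ S, ∀ v ∈ S, Filter.Tendsto (fun t : ℝ => ((t : ℂ))⁻¹ * ⟪u, (Λ t A - A) v⟫_ℂ)
      (nhdsWithin 0 (Set.Ioi 0)) (nhds ⟪u, C v⟫_ℂ) := by
    intro u hu v hv
    have h1 := h u hu v hv 0 le_rfl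
    rw [← hasDerivWithinAt_Ioi_iff_Ici, hasDerivWithinAt_iff_tendsto_slope' (by simp)] at h1
    simpa only [slope_fun_def, sub_zero, hΛ.zero, LinearMap.id_apply, vsub_eq_sub,
      Complex.real_smul, Complex.ofReal_inv, sub_apply, inner_sub_right] using h1
  have hmap : Filter.map ((↑) : Set.Ioc (0 : ℝ) 1 → ℝ) (Filter.comap (↑) (nhdsWithin (0 : ℝ) (Set.Ioi 0)))
      = nhdsWithin (0 : ℝ) (Set.Ioi 0) :=
    Filter.map_comap_of_mem (by
      rw [Subtype.range_coe]; exact Ioc_mem_nhdsGT one_pos)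
  intro u v
  rw [← hmap, Filter.tendsto_map'_iff]
  have h2 := tendsto_inner_of_dense (f := Filter.comap (↑) (nhdsWithin (0 : ℝ) (Set.Ioi 0)))
    (X₀ := C) hD hS (fun u hu v hv => ?_) u v
  · simpa only [D, smul_apply, inner_smul_right, Function.comp_def] using h2
  · simpa only [D, smul_apply, inner_smul_right, Function.comp_def] using
      (hlim u hu v hv).comp Filter.tendsto_comap

namespace EigenBasis
variable {ι : Type}

/-- Convergence of matrix elements alone would not give `IsGen Λ A' C'`. The modular relation is
therefore used at all times: the matrix elements of `Λ r A'` are fixed multiples of those of `Λ r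
A`, so their right derivatives are known for every `s ≥ 0`. -/
theorem isGen_iff_isModular (b : EigenBasis ħ B ι) (hB : B.IsSymm) (hβ : 0 < β)
    {Λ : ℝ → (Obs n →ₗ[ℂ] Obs n)} (hΛ : IsQDS Λ) (hDB : DetailedBalance ħ β B Λ) {z : ℂ}
    {A A' C C' : Obs n} (h : IsModular ħ B z A A') (hA : IsGen Λ A C) :
    IsGen Λ A' C' ↔ IsModular ħ B z C C' := by
  have hΛA := fun t (ht : 0 ≤ t) => (b.isModular_iff hB).1 (b.isModular_map hB hβ hΛ hDB ht h)
  constructor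
  · intro hA'
    rw [b.isModular_iff hB] at h ⊢
    intro i j
    refine tendsto_nhds_unique (hA' (b.b i) (b.b j)) (((hA (b.b i) (b.b j)).const_mul _).congr' ?_)
    filter_upwards [self_mem_nhdsWithin] with t ht
    simp only [sub_apply, inner_sub_right, h, hΛA t (le_of_lt ht)]
    ring
  · intro hC
    have hij : ∀ i j s, 0 ≤ s → HasDerivWithinAt (fun r => ⟪b.b i, Λ r A' (b.b j)⟫_ℂ)
        ⟪b.b i, Λ s C' (b.b j)⟫_ℂ (Set.Ici s) s := by
      intro i j s hs
      rw [(b.isModular_iff hB).1 (b.isModular_map hB hβ hΛ hDB hs hC) i j]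
      exact ((hΛ.hasDerivWithinAt hA hs (b.b i) (b.b j)).const_mul _).congr
        (fun r hr => hΛA r (hs.trans hr) i j) (hΛA s hs i j)
    refine hΛ.isGen_of_dense (S := (Submodule.span ℂ (Set.range b.b) : Set (Hilb n)))
      (Submodule.dense_iff_topologicalClosure_eq_top.2 b.b.dense_span) ?_
    intro u hu v hv s hs
    induction hu using Submodule.span_induction with
    | zero => simpa using hasDerivWithinAt_const s (Set.Ici s) (0 : ℂ)
    | add x y _ _ hx hy => simpa only [inner_add_left] using hx.fun_add hy
    | smul c x _ hx => simpa only [inner_smul_left] using hx.const_mul _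
    | mem x hx =>
      obtain ⟨i, rfl⟩ := hx
      induction hv using Submodule.span_induction with
      | zero => simpa using hasDerivWithinAt_const s (Set.Ici s) (0 : ℂ)
      | add x y _ _ hx hy => simpa only [map_add, inner_add_right] using hx.fun_add hy
      | smul c x _ hx => simpa only [map_smul, inner_smul_right] using hx.const_mul _
      | mem x hx =>
        obtain ⟨j, rfl⟩ := hx
        exact hij i j s hs

end EigenBasis

/-! ### Finite-dimensional invariant subspaces -/

/-- The span of `V` and its images under the canonical operators. -/
def extend (ħ : ℝ) (V : Submodule ℂ (Schw n)) : Submodule ℂ (Schw n) :=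
  V ⊔ ⨆ j, V.map (xOp ħ j).toLinearMap

theorem le_extend (ħ : ℝ) (V : Submodule ℂ (Schw n)) : V ≤ extend ħ V := le_sup_left

theorem xOp_mem_extend (ħ : ℝ) {V : Submodule ℂ (Schw n)} (j : Idx n) {φ : Schw n} (h : φ ∈ V) :
    xOp ħ j φ ∈ extend ħ V :=
  Submodule.mem_sup_right (Submodule.mem_iSup_of_mem j ⟨φ, h, rfl⟩)

theorem linOp_mem_extend (ħ : ℝ) {V : Submodule ℂ (Schw n)} (c : Idx n → ℂ) {φ : Schw n}
    (h : φ ∈ V) : linOp ħ c φ ∈ extend ħ V := by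
  rw [linOp_apply]
  exact Submodule.sum_mem _ fun j _ => Submodule.smul_mem _ _ (xOp_mem_extend ħ j h)

theorem quadOp_mem_extend (ħ : ℝ) {V : Submodule ℂ (Schw n)} (M : Matrix (Idx n) (Idx n) ℝ)
    {φ : Schw n} (h : φ ∈ V) : quadOp ħ M φ ∈ extend ħ (extend ħ V) := by
  rw [quadOp_apply]
  exact Submodule.smul_mem _ _ (Submodule.sum_mem _ fun j _ => Submodule.sum_mem _ fun k _ =>
    Submodule.smul_mem _ _ (xOp_mem_extend ħ j (xOp_mem_extend ħ k h)))

instance (ħ : ℝ) (V : Submodule ℂ (Schw n)) [FiniteDimensional ℂ V] :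
    FiniteDimensional ℂ (extend ħ V) := by
  unfold extend; infer_instance

/-- The commutator of a quadratic operator with `x̂_l` is linear in the canonical operators, hence
maps `V` into `extend ħ V`. -/
theorem quadOp_mem_extend_of_invariant (ħ : ℝ) {V : Submodule ℂ (Schw n)}
    (M : Matrix (Idx n) (Idx n) ℝ) (hV : ∀ φ ∈ V, quadOp ħ M φ ∈ V) :
    ∀ φ ∈ extend ħ V, quadOp ħ M φ ∈ extend ħ V := by
  have hx : ∀ l, ∀ φ ∈ V, quadOp ħ M (xOp ħ l φ) ∈ extend ħ V := by
    intro l φ hφ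
    choose c hc using fun j => exists_commutator_xOp (n := n) ħ j l
    have h1 : quadOp ħ M (xOp ħ l φ) = xOp ħ l (quadOp ħ M φ) + (1 / 2 : ℂ) • ∑ j, ∑ k,
        ((M j k : ℝ) : ℂ) • (c j • xOp ħ k φ + c k • xOp ħ j φ) := by
      simp only [quadOp_apply, map_smul, map_sum, hc, map_add, ← smul_add,
        ← Finset.sum_add_distrib, add_assoc]
    rw [h1]
    refine Submodule.add_mem _ (xOp_mem_extend ħ l (hV φ hφ)) ?_
    exact Submodule.smul_mem _ _ (Submodule.sum_mem _ fun j _ => Submodule.sum_mem _ fun k _ =>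
      Submodule.smul_mem _ _ (Submodule.add_mem _
        (Submodule.smul_mem _ _ (xOp_mem_extend ħ k hφ))
        (Submodule.smul_mem _ _ (xOp_mem_extend ħ j hφ))))
  have : extend ħ V ≤ (extend ħ V).comap (quadOp ħ M).toLinearMap := by
    refine sup_le (fun φ hφ => le_extend ħ V (hV φ hφ)) (iSup_le fun l => ?_)
    rintro _ ⟨φ, hφ, rfl⟩
    exact hx l φ hφ
  exact fun φ hφ => this hφ

namespace EigenBasis
variable {ι : Type} (b : EigenBasis ħ B ι)

theorem finite_energy_le (hβ : 0 < β) (hs : Summable fun i => Real.exp (-β * b.energy i)) (c : ℝ) :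
    {i | b.energy i ≤ c}.Finite := by
  have h0 := hs.tendsto_cofinite_zero.eventually_lt_const (Real.exp_pos (-β * c))
  refine (Filter.eventually_cofinite.1 h0).subset fun i hi => ?_
  have : b.energy i ≤ c := hi
  simp only [Set.mem_ofPred_eq, not_lt, Real.exp_le_exp]
  nlinarith

/-- Finite-dimensional invariant subspaces are spanned by finitely many basis vectors. -/
theorem exists_finset_expansion (hB : B.IsSymm) (hβ : 0 < β)
    (hs : Summable fun i => Real.exp (-β * b.energy i)) {V : Submodule ℂ (Schw n)}
    [FiniteDimensional ℂ V] (hV : ∀ φ ∈ V, quadOp ħ B φ ∈ V) :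
    ∃ T : Finset ι, ∀ φ ∈ V, φ = ∑ i ∈ T, ⟪b.b i, toH φ⟫_ℂ • b.e i := by
  let f : Module.End ℂ V := (quadOp ħ B).toLinearMap.restrict hV
  have hf : ∀ φ : V, ((f φ : V) : Schw n) = quadOp ħ B φ := fun φ => rfl
  have hL : ∀ i (φ : V), ⟪b.b i, toH (f φ : Schw n)⟫_ℂ = b.energy i * ⟪b.b i, toH (φ : Schw n)⟫_ℂ := by
    intro i φ
    rw [hf, ← b.toH_e, inner_toH_quadOp ħ hB, b.isEigen, map_smul, inner_smul_left,
      Complex.conj_ofReal]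
  have hpow : ∀ i (m : ℕ) (φ : V), ⟪b.b i, toH ((f ^ m) φ : Schw n)⟫_ℂ =
      (b.energy i : ℂ) ^ m * ⟪b.b i, toH (φ : Schw n)⟫_ℂ := by
    intro i m
    induction m with
    | zero => intro φ; simp
    | succ m ih =>
      intro φ
      rw [pow_succ, Module.End.mul_apply, ih, hL]
      ring
  have hq : ∀ i (q : Polynomial ℂ) (φ : V), ⟪b.b i, toH (Polynomial.aeval f q φ : Schw n)⟫_ℂ =
      q.eval (b.energy i : ℂ) * ⟪b.b i, toH (φ : Schw n)⟫_ℂ := by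
    intro i q φ
    induction q using Polynomial.induction_on' with
    | add p q hp hq =>
      simp only [map_add, LinearMap.add_apply, Submodule.coe_add, inner_add_right, hp, hq,
        Polynomial.eval_add, add_mul]
    | monomial m a =>
      simp only [Polynomial.aeval_monomial, Module.End.mul_apply, Module.algebraMap_end_apply,
        Submodule.coe_smul, map_smul, inner_smul_right, hpow, Polynomial.eval_monomial, mul_assoc]
  -- The minimal polynomial of `Ĥ` on `V` annihilates every coefficient whose energy is not one of
  -- its roots. The real roots are bounded by some `c`, and only finitely many energies lie below
  -- `c`.
  have hp0 : minpoly ℂ f ≠ 0 := minpoly.ne_zero (Algebra.IsIntegral.isIntegral f)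
  have hfin : {x : ℝ | (minpoly ℂ f).eval (x : ℂ) = 0}.Finite := by
    have h1 : {x : ℝ | (minpoly ℂ f).eval (x : ℂ) = 0} ⊆
        Complex.ofReal ⁻¹' ((minpoly ℂ f).roots.toFinset : Set ℂ) := by
      intro x hx
      simpa [hp0] using hx
    exact (Set.Finite.preimage Complex.ofReal_injective.injOn (Finset.finite_toSet _)).subset h1
  obtain ⟨c, hc⟩ := hfin.bddAbove
  refine ⟨(b.finite_energy_le hβ hs c).toFinset, fun φ hφ => toH_injective ?_⟩
  have h1 := b.b.hasSum_repr (toH φ)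
  rw [map_sum]
  refine h1.unique ?_
  convert hasSum_sum_of_ne_finset_zero (f := fun i => b.b.repr (toH φ) i • b.b i)
    (s := (b.finite_energy_le hβ hs c).toFinset) ?_ using 1
  · exact Finset.sum_congr rfl fun i _ => by
      rw [map_smul, b.toH_e, HilbertBasis.repr_apply_apply]
  · intro i hi
    rw [HilbertBasis.repr_apply_apply]
    have h2 := hq i (minpoly ℂ f) ⟨φ, hφ⟩
    rw [minpoly.aeval] at h2
    simp only [LinearMap.zero_apply, Submodule.coe_zero, map_zero, inner_zero_right] at h2
    rcases mul_eq_zero.1 h2.symm with h3 | h3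
    · exact absurd (hc h3) (by simpa using hi)
    · simp only [h3, zero_smul]
  · infer_instance

theorem exists_finset_expansion_extend (hB : B.IsSymm) (hβ : 0 < β)
    (hs : Summable fun i => Real.exp (-β * b.energy i)) {E : ℝ} {φ : Schw n}
    (hφ : IsEigen ħ B E φ) :
    ∃ T : Finset ι, ∀ χ ∈ extend ħ (extend ħ (Submodule.span ℂ {φ})),
      χ = ∑ i ∈ T, ⟪b.b i, toH χ⟫_ℂ • b.e i := by
  refine b.exists_finset_expansion hB hβ hs
    (quadOp_mem_extend_of_invariant ħ B (quadOp_mem_extend_of_invariant ħ B ?_))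
  intro χ hχ
  obtain ⟨a, rfl⟩ := Submodule.mem_span_singleton.1 hχ
  rw [map_smul, hφ]
  exact Submodule.smul_mem _ _ (Submodule.smul_mem _ _ (Submodule.mem_span_singleton_self φ))

end EigenBasis

/-! ### The Lindblad generator on tempered operators -/

theorem lindblad_sum {K : ℕ} (ħ : ℝ) (B' : Matrix (Idx n) (Idx n) ℝ) (ξ' : Idx n → ℝ)
    (l : Fin K → Idx n → ℂ) {κ : Type*} (s : Finset κ) (c : κ → ℂ)
    (G : κ → Schw n → Schw n → ℂ) (φ ψ : Schw n) :
    lindblad ħ B' ξ' l (fun φ ψ => ∑ p ∈ s, c p * G p φ ψ) φ ψ =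
      ∑ p ∈ s, c p * lindblad ħ B' ξ' l (G p) φ ψ := by
  classical
  induction s using Finset.induction_on with
  | empty => simp [lindblad]
  | insert a s ha ih =>
    rw [Finset.sum_insert ha, ← ih]
    simp only [lindblad, Finset.sum_insert ha, mul_add, add_sub_add_comm, Finset.sum_add_distrib]
    simp only [Finset.mul_sum, mul_sub, Finset.sum_sub_distrib]
    ring_nf

/-- The generator is at most quadratic in the canonical operators, so it sees a form only on vectors
reached by two of them. -/
theorem lindblad_congr {K : ℕ} (ħ : ℝ) (B' : Matrix (Idx n) (Idx n) ℝ) (ξ' : Idx n → ℝ)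
    (l : Fin K → Idx n → ℂ) {F G : Schw n → Schw n → ℂ} {φ ψ : Schw n}
    (h : ∀ χ ∈ extend ħ (extend ħ (Submodule.span ℂ {φ})),
      ∀ ω ∈ extend ħ (extend ħ (Submodule.span ℂ {ψ})), F χ ω = G χ ω) :
    lindblad ħ B' ξ' l F φ ψ = lindblad ħ B' ξ' l G φ ψ := by
  have h0 : ∀ φ : Schw n, φ ∈ extend ħ (extend ħ (Submodule.span ℂ {φ})) := fun φ =>
    le_extend ħ _ (le_extend ħ _ (Submodule.mem_span_singleton_self φ))
  have hH : ∀ φ : Schw n, effHam ħ B' ξ' φ ∈ extend ħ (extend ħ (Submodule.span ℂ {φ})) :=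
    fun φ => Submodule.add_mem _
      (quadOp_mem_extend ħ _ (Submodule.mem_span_singleton_self φ))
      (linOp_mem_extend ħ _ (le_extend ħ _ (Submodule.mem_span_singleton_self φ)))
  have hl : ∀ k (φ : Schw n), lindOp ħ (l k) φ ∈ extend ħ (Submodule.span ℂ {φ}) :=
    fun k φ => linOp_mem_extend ħ _ (Submodule.mem_span_singleton_self φ)
  have hl' : ∀ k (φ : Schw n), lindOp ħ (l k) φ ∈ extend ħ (extend ħ (Submodule.span ℂ {φ})) :=
    fun k φ => le_extend ħ _ (hl k φ)
  have hll : ∀ k (φ : Schw n), lindOpAdj ħ (l k) (lindOp ħ (l k) φ) ∈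
      extend ħ (extend ħ (Submodule.span ℂ {φ})) := fun k φ => linOp_mem_extend ħ _ (hl k φ)
  simp only [lindblad, h _ (h0 φ) _ (hH ψ), h _ (hH φ) _ (h0 ψ), h _ (hl' _ φ) _ (hl' _ ψ),
    h _ (h0 φ) _ (hll _ ψ), h _ (hll _ φ) _ (h0 ψ)]

theorem IsTempered.sum_left {F : Schw n → Schw n → ℂ} (hF : IsTempered F) {κ : Type*}
    (s : Finset κ) (c : κ → ℂ) (e : κ → Schw n) (ψ : Schw n) :
    F (∑ k ∈ s, c k • e k) ψ = ∑ k ∈ s, star (c k) * F (e k) ψ := by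
  classical
  induction s using Finset.induction_on with
  | empty => simpa using hF.smul_left 0 0 ψ
  | insert a s ha ih => rw [Finset.sum_insert ha, Finset.sum_insert ha, hF.add_left, hF.smul_left, ih]

theorem IsTempered.sum_right {F : Schw n → Schw n → ℂ} (hF : IsTempered F) {κ : Type*}
    (s : Finset κ) (c : κ → ℂ) (e : κ → Schw n) (φ : Schw n) :
    F φ (∑ k ∈ s, c k • e k) = ∑ k ∈ s, c k * F φ (e k) := by
  classical
  induction s using Finset.induction_on with
  | empty => simpa using hF.smul_right 0 φ 0
  | insert a s ha ih =>
    rw [Finset.sum_insert ha, Finset.sum_insert ha, hF.add_right, hF.smul_right, ih]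

namespace EigenBasis
variable {ι : Type}

/-- The matrix element vanishes for all `s ≥ 0`, so its derivative at `0`, which the master equation
equates with `lindblad`, is zero. -/
theorem lindblad_unit_eq_zero (b : EigenBasis ħ B ι) (hB : B.IsSymm) (hβ : 0 < β) {K : ℕ}
    {B' : Matrix (Idx n) (Idx n) ℝ} {ξ' : Idx n → ℝ} {l : Fin K → Idx n → ℂ}
    {Λ : ℝ → (Obs n →ₗ[ℂ] Obs n)} (hΛ : IsGDS ħ B' ξ' l Λ) (hDB : DetailedBalance ħ β B Λ)
    {i j : ι} {E E' : ℝ} {φ ψ : Schw n} (hφ : IsEigen ħ B E φ) (hψ : IsEigen ħ B E' ψ)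
    (h : E - E' ≠ b.energy i - b.energy j) :
    lindblad ħ B' ξ' l (matEl (b.unit i j)) φ ψ = 0 := by
  have h1 := hΛ.master (b.unit i j) φ ψ 0 le_rfl
  rw [hΛ.isQDS.zero, LinearMap.id_apply] at h1
  refine (uniqueDiffWithinAt_Ici (0 : ℝ)).eq_deriv _ h1 ?_
  exact (hasDerivWithinAt_const 0 (Set.Ici 0) (0 : ℂ)).congr
    (fun s hs => b.matEl_map_unit_eq_zero hB hβ hΛ.isQDS hDB hs hφ hψ h)
    (b.matEl_map_unit_eq_zero hB hβ hΛ.isQDS hDB le_rfl hφ hψ h)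

theorem isModularForm_lindblad (b : EigenBasis ħ B ι) (hB : B.IsSymm) (hβ : 0 < β)
    (hs : Summable fun i => Real.exp (-β * b.energy i)) {K : ℕ}
    {B' : Matrix (Idx n) (Idx n) ℝ} {ξ' : Idx n → ℝ} {l : Fin K → Idx n → ℂ}
    {Λ : ℝ → (Obs n →ₗ[ℂ] Obs n)} (hΛ : IsGDS ħ B' ξ' l Λ) (hDB : DetailedBalance ħ β B Λ)
    {z : ℂ} {F F' : Schw n → Schw n → ℂ} (hF : IsTempered F) (hF' : IsTempered F')
    (h : IsModularForm ħ B z F F') :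
    IsModularForm ħ B z (lindblad ħ B' ξ' l F) (lindblad ħ B' ξ' l F') := by
  intro E E' φ ψ hφ hψ
  obtain ⟨T, hT⟩ := b.exists_finset_expansion_extend hB hβ hs hφ
  obtain ⟨T', hT'⟩ := b.exists_finset_expansion_extend hB hβ hs hψ
  -- On the relevant finite-dimensional spaces `G` is a finite sum of matrix units, so no
  -- convergence question arises for unbounded `G`.
  have key : ∀ {G : Schw n → Schw n → ℂ}, IsTempered G → lindblad ħ B' ξ' l G φ ψ =
      ∑ p ∈ T ×ˢ T', G (b.e p.1) (b.e p.2) * lindblad ħ B' ξ' l (matEl (b.unit p.1 p.2)) φ ψ := by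
    intro G hG
    rw [← lindblad_sum]
    refine lindblad_congr ħ B' ξ' l fun χ hχ ω hω => ?_
    conv_lhs => rw [hT χ hχ, hT' ω hω, hG.sum_left]
    rw [Finset.sum_product]
    refine Finset.sum_congr rfl fun i _ => ?_
    rw [hG.sum_right, Finset.mul_sum]
    refine Finset.sum_congr rfl fun j _ => ?_
    rw [matEl, unit_apply, inner_smul_right, Complex.star_def, inner_conj_symm]
    ring
  rw [key hF, key hF', Finset.mul_sum]
  refine Finset.sum_congr rfl fun p _ => ?_
  rw [h _ _ _ _ (b.isEigen p.1) (b.isEigen p.2)]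
  by_cases hE : E - E' = b.energy p.1 - b.energy p.2
  · have : (E : ℂ) - E' = b.energy p.1 - b.energy p.2 := by exact_mod_cast hE
    rw [this]; ring
  · rw [b.lindblad_unit_eq_zero hB hβ hΛ hDB hφ hψ hE]; ring

end EigenBasis

end GDS

end

theorem theorem3 (n K : ℕ) (ħ β : ℝ) (hħ : 0 < ħ) (hβ : 0 < β)
    (B : Matrix (GDS.Idx n) (GDS.Idx n) ℝ) (hB : B.PosDef)
    (B' : Matrix (GDS.Idx n) (GDS.Idx n) ℝ) (hB' : B'.IsSymm)
    (ξ' : GDS.Idx n → ℝ) (l : Fin K → GDS.Idx n → ℂ)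
    (Λ : ℝ → (GDS.Obs n →ₗ[ℂ] GDS.Obs n))
    (hΛ : GDS.IsGDS ħ B' ξ' l Λ) (hDB : GDS.DetailedBalance ħ β B Λ) :
    (∀ t : ℝ, 0 ≤ t → ∀ (z : ℂ) (A A' : GDS.Obs n),
      GDS.IsModular ħ B z A A' → GDS.IsModular ħ B z (Λ t A) (Λ t A')) ∧
    (∀ t : ℝ, 0 ≤ t → ∀ (z : ℂ) (F F' G G' : GDS.Schw n → GDS.Schw n → ℂ),
      GDS.IsTempered F → GDS.IsTempered F' → GDS.IsTempered G → GDS.IsTempered G' →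
      GDS.IsModularForm ħ B z F F' →
      GDS.IsEvolved ħ B (Λ t) F G → GDS.IsEvolved ħ B (Λ t) F' G' →
      GDS.IsModularForm ħ B z G G') ∧
    (∀ (z : ℂ) (A A' C : GDS.Obs n), GDS.IsModular ħ B z A A' → GDS.IsGen Λ A C →
      ∀ C' : GDS.Obs n, GDS.IsGen Λ A' C' ↔ GDS.IsModular ħ B z C C') ∧
    (∀ (z : ℂ) (F F' : GDS.Schw n → GDS.Schw n → ℂ), GDS.IsTempered F → GDS.IsTempered F' →
      GDS.IsModularForm ħ B z F F' →
      GDS.IsModularForm ħ B z (GDS.lindblad ħ B' ξ' l F) (GDS.lindblad ħ B' ξ' l F')) := by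
  have hBs : B.IsSymm := by
    simpa only [Matrix.conjTranspose_eq_transpose_of_trivial, Matrix.IsSymm] using hB.isHermitian.eq
  have htr : GDS.HasTrace ħ β B := by
    -- At time zero, detailed balance for the identity asserts the existence of the partition
    -- function `Tr e^{-βĤ}`.
    obtain ⟨c, h, -⟩ := hDB 0 le_rfl 1 1
    rw [hΛ.isQDS.zero] at h
    exact h.hasTrace
  obtain ⟨ι, b, hs⟩ := htr.exists_eigenBasis hBs
  exact ⟨fun t ht z A A' h => b.isModular_map hBs hβ hΛ.isQDS hDB ht h,
    fun t ht z F F' G G' _ _ _ _ h hG hG' =>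
      b.isModularForm_of_isEvolved hBs hβ hΛ.isQDS hDB ht h hG hG',
    fun z A A' C h hA C' => b.isGen_iff_isModular hBs hβ hΛ.isQDS hDB h hA,
    fun z F F' hF hF' h => b.isModularForm_lindblad hBs hβ hs hΛ hDB hF hF' h⟩
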